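/- Let $x\in\mathbb R$, $v,z\in\mathbb C$ with $z\neq 0$, let $\rho>0$ and let $\alpha\ne\beta$ be complex numbers with $1+\bar\alpha\beta\neq0$ such that for all $\zeta\ne0$ $$\eta^{(4)}(\zeta)=\frac{\bar z}{\zeta^2}+\frac{\bar v}{\zeta}+x-v\zeta+z\zeta^2=\frac{\rho}{\zeta^2}\,\frac{(\zeta-\alpha)(\bar\alpha\zeta+1)}{1+|\alpha|^2}\,\frac{(\zeta-\beta)(\bar\beta\zeta+1)}{1+|\beta|^2}.$$ Fix a square root $\sqrt z$ and put $x_\pm=(x\pm6|z|)/3$, $$g_2=4|z|^2+|v|^2+\tfrac13x^2,\qquad g_3=\tfrac83|z|^2x-\tfrac13|v|^2x-\tfrac2{27}x^3-z\bar v^2-\bar zv^2 .$$ Let $\Lambda$ be the lattice whose Weierstrass function is $\wp(u)=\wp(u;4g_2,4g_3)$, let $\sigma$ and $\zeta_W$ be the Weierstrass sigma and zeta functions of $\Lambda$, let $2\omega_1,2\omega_3$ be a basis of $\Lambda$, $\omega_2=-\omega_1-\omega_3$, $\eta_i=\zeta_W(\omega_i)$, and $\pi_i(w)=w\,\zeta_W(\omega_i)-\omega_i\,\zeta_W(w)$.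 Let $k^2=\frac{|1+\bar\alpha\beta|^2}{(1+|\alpha|^2)(1+|\beta|^2)}$, $e_1=-\frac\rho3(k^2-2)$, $e_3=-\frac\rho3(k^2+1)$. A point $(\zeta,\eta)$ of the curve $\eta^2=\zeta^2\eta^{(4)}(\zeta)$ with $\zeta\ne\beta$ is sent to the point $(X_\zeta,Y)$ of the cubic $Y^2=X^3-g_2X-g_3$ by $$\frac{X_\zeta-e_3}{e_1-e_3}=\frac{(\zeta-\alpha)(-1/\bar\alpha-\beta)}{(\zeta-\beta)(-1/\bar\alpha-\alpha)},\qquad \frac{d\zeta}{2\eta}=\frac{dX}{2Y},$$ $\zeta=\beta$ is sent to $X=\infty$, and $u$ is a Jacobian coordinate of $(X,Y)$ if $X=\wp(u)$, $2Y=\wp'(u)$ ($u\in\Lambda$ for $X=\infty$). Let $X_\infty=\lim_{\zeta\to\infty}X_\zeta$, $Y_\infty=-\beta\sqrt z\,(X_\infty-X_0)$, let $u_\infty$ be a Jacobian coordinate of $(X_\infty,Y_\infty)$ and let $u_0$ be a Jacobian coordinate of the image of $(\zeta,\eta)=(0,-\overline{\sqrt z})$. Put $u_\infty^\pm=u_\infty\pm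 u_0$. Then $u_\infty^\pm\notin\Lambda$, $\wp(u_\infty^\pm)=x_\pm$, and the following holds. (1) Incomplete integrals. Let $\Gamma$ be a contour of finite points $(\zeta,\eta)$ of the curve $\eta^2=\zeta^2\eta^{(4)}(\zeta)$, with a piecewise smooth lift to the Jacobian running from $u_a$ to $u_b$. With $\sqrt{\eta^{(4)}}=\eta/\zeta$, the integrals $$\mathcal I_m=\int_\Gamma\frac{d\zeta}{\zeta}\,\frac{\zeta^m}{2\sqrt{\eta^{(4)}}}=\int_\Gamma\frac{\zeta^m\,d\zeta}{2\eta}\qquad(m=0,1,2)$$ converge, and, with a continuous branch of the logarithm along the lift and $[F(u)]=F(u_b)-F(u_a)$, $$\mathcal I_0=[u],\qquad \mathcal I_1=-\frac1{2\sqrt z}\Big[\ln\frac{\sigma(u-u_\infty)}{\sigma(u+u_\infty)}+\big(\zeta_W(u_\infty^+)+\zeta_W(u_\infty^-)\big)u\Big],$$ $$\mathcal I_2=-\frac1{4z}\Big[\zeta_W(u-u_\infty)+\zeta_W(u+u_\infty)+(x_++x_-)u+\frac v{\sqrt z}\Big(\ln\frac{\sigma(u-u_\infty)}{\sigma(u+u_\infty)}+\big(\zeta_W(u_\infty^+)+\zeta_W(u_\infty^-)\big)u\Big)\Big].$$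 (2) Complete integrals. Put $$P_i=\pi_i(u_\infty^+)+\pi_i(u_\infty^-),\qquad C_1^{(i)}=\frac1{\sqrt z}P_i,\qquad C_2^{(i)}=-\frac1{2z}\Big[2\eta_i+(x_++x_-)\omega_i-\frac v{\sqrt z}P_i\Big].$$ If the lift of $\Gamma$ satisfies $u_b-u_a=2\omega_i$, where $i\in\{1,2,3\}$, then $\mathcal I_0=2\omega_i$ and, for some integer $n$ (the same in both formulas; it accounts for the residues at the two points over $\zeta=\infty$), $$\mathcal I_1=C_1^{(i)}+n\,\frac{\pi i}{\sqrt z},\qquad \mathcal I_2=C_2^{(i)}+\frac{v}{2z}\,n\,\frac{\pi i}{\sqrt z}$$ (in $\pi i$, $i$ is the imaginary unit). (3) Let $\Gamma_1,\Gamma_2,\Gamma_3$ be the closed contours whose lifts are the segments from $b_i$ to $b_i+2\omega_i$ with $b_1=\omega_2$, $b_2=\omega_3$, $b_3=\omega_2$. If the representative $u_\infty$ is of the form $p\,\omega_i+q\,b_i$ with $p,q\in\mathbb R$, $|q|<1$, then exactly $$\mathcal I_0^{(i)}=2\omega_i,\qquad \mathcal I_1^{(i)}=C_1^{(i)},\qquad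 \mathcal I_2^{(i)}=C_2^{(i)}.$$ -/

import Mathlib

noncomputable section

namespace PeriodPair

/-- The Weierstrass zeta function of the lattice `Λ`,
`ζ(u) = 1/u + ∑_{l ∈ Λ, l ≠ 0} (1/(u - l) + 1/l + u/l²)`;
with `1 / 0 = 0` the summand at `l = 0` is exactly `1/u`. -/
def weierstrassZeta (L : PeriodPair) (u : ℂ) : ℂ :=
  ∑' l : L.lattice, (1 / (u - l) + 1 / (l : ℂ) + u / (l : ℂ) ^ 2)

/-- The Weierstrass sigma function of the lattice `Λ`,
`σ(u) = u ∏_{l ∈ Λ, l ≠ 0} (1 - u/l) exp (u/l + u²/(2l²))`. -/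
def weierstrassSigma (L : PeriodPair) (u : ℂ) : ℂ :=
  u * ∏' l : {l : L.lattice // l ≠ 0},
    (1 - u / (l.1 : ℂ)) * Complex.exp (u / (l.1 : ℂ) + u ^ 2 / (2 * (l.1 : ℂ) ^ 2))

/-- The half-periods `ω₁, ω₂, ω₃` (indexed by `0, 1, 2`). The lattice is generated by `2ω₁` and
`2ω₃`, and `ω₁ + ω₂ + ω₃ = 0`. -/
def halfPeriod (L : PeriodPair) : Fin 3 → ℂ :=
  ![L.ω₁ / 2, -(L.ω₁ / 2) - L.ω₂ / 2, L.ω₂ / 2]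

/-- `ηᵢ = ζ(ωᵢ)`. -/
def quasiHalfPeriod (L : PeriodPair) (i : Fin 3) : ℂ :=
  L.weierstrassZeta (L.halfPeriod i)

/-- The complete integral of the third kind: the determinant
`w ζ(ωᵢ) - ωᵢ ζ(w)`, where `w` is the Jacobian coordinate of the pole. -/
def thirdKind (L : PeriodPair) (i : Fin 3) (w : ℂ) : ℂ :=
  w * L.weierstrassZeta (L.halfPeriod i) - L.halfPeriod i * L.weierstrassZeta w

/-- The starting points on the Jacobian of the closed contours `Γ₁, Γ₂, Γ₃`:
these start at `ω₂`, `ω₃`, `ω₂` respectively. -/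
def contourBase (L : PeriodPair) : Fin 3 → ℂ :=
  ![L.halfPeriod 1, L.halfPeriod 2, L.halfPeriod 1]

/-- The closed contour `Γᵢ` on the Jacobian: from a half-period `ωⱼ` straight through
`ωⱼ + ωᵢ = -ωₖ` to `ωⱼ + 2ωᵢ`, with `{i, j, k} = {1, 2, 3}`. Under `X = ℘(u)` it runs from
`eⱼ = ℘(ωⱼ)` to `eₖ = ℘(ωₖ)` and back to `eⱼ` on the other sheet; for the basis with `ω₁ > 0` and
`ω₃ ∈ iℝ₊` it is the loop that surrounds the cut joining `eⱼ` and `eₖ`. -/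
def closedContour (L : PeriodPair) (i : Fin 3) (t : ℝ) : ℂ :=
  L.contourBase i + 2 * t * L.halfPeriod i

/-- `u` is a Jacobian coordinate of the point `(X, Y)`, `X = ℘(u)` and `2Y = ℘'(u)`. -/
def HasCoord (L : PeriodPair) (X Y u : ℂ) : Prop :=
  u ∉ L.lattice ∧ L.weierstrassP u = X ∧ L.derivWeierstrassP u = 2 * Y

end PeriodPair

namespace O4

open ComplexConjugate

/-- The `O(4)` multiplet `η⁽⁴⁾(ζ) = z̄/ζ² + v̄/ζ + x - vζ + zζ²`. -/
def eta4 (x : ℝ) (v z ζ : ℂ) : ℂ :=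
  conj z / ζ ^ 2 + conj v / ζ + x - v * ζ + z * ζ ^ 2

/-- The quartic `ζ² η⁽⁴⁾(ζ)`. -/
def quartic (x : ℝ) (v z ζ : ℂ) : ℂ :=
  conj z + conj v * ζ + x * ζ ^ 2 - v * ζ ^ 3 + z * ζ ^ 4

theorem quartic_eq (x : ℝ) (v z ζ : ℂ) (hζ : ζ ≠ 0) :
    quartic x v z ζ = ζ ^ 2 * eta4 x v z ζ := by
  unfold quartic eta4
  field_simp

/-- `g₂ = 4|z|² + |v|² + x²/3`, for the cubic `Y² = X³ - g₂ X - g₃`. -/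
def g2 (x : ℝ) (v z : ℂ) : ℂ :=
  4 * (‖z‖ : ℂ) ^ 2 + (‖v‖ : ℂ) ^ 2 + (x : ℂ) ^ 2 / 3

/-- `g₃ = 8/3 |z|² x - 1/3 |v|² x - 2/27 x³ - z v̄² - z̄ v²`. -/
def g3 (x : ℝ) (v z : ℂ) : ℂ :=
  8 / 3 * (‖z‖ : ℂ) ^ 2 * x - 1 / 3 * (‖v‖ : ℂ) ^ 2 * x - 2 / 27 * (x : ℂ) ^ 3
    - z * conj v ^ 2 - conj z * v ^ 2

/-- The square of the chordal distance, `k² = |1 + ᾱβ|² / ((1 + |α|²)(1 + |β|²))`. -/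
def kSq (α β : ℂ) : ℝ :=
  ‖1 + conj α * β‖ ^ 2 / ((1 + ‖α‖ ^ 2) * (1 + ‖β‖ ^ 2))

/-- The Weierstrass root `e₁ = -ρ/3 (k² - 2)`. -/
def e1 (ρ : ℝ) (α β : ℂ) : ℝ := -(ρ / 3) * (kSq α β - 2)

/-- The Weierstrass root `e₃ = -ρ/3 (k² + 1)`. -/
def e3 (ρ : ℝ) (α β : ℂ) : ℝ := -(ρ / 3) * (kSq α β + 1)

/-- The cross-ratio `[z₁, z₂, z₃, z₄]`. -/
def crossRatio (z₁ z₂ z₃ z₄ : ℂ) : ℂ :=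
  ((z₁ - z₃) * (z₂ - z₄)) / ((z₁ - z₄) * (z₂ - z₃))

/-- The birational map `ζ ↦ X_ζ`, given by `[ζ, -1/ᾱ, α, β] = (X - e₃)/(e₁ - e₃)`. -/
def XMap (ρ : ℝ) (α β ζ : ℂ) : ℂ :=
  e3 ρ α β + (e1 ρ α β - e3 ρ α β) * crossRatio ζ (-1 / conj α) α β

/-- The second coordinate of the image on the cubic of the point `(ζ, η)` of the curve
`η² = ζ² η⁽⁴⁾(ζ)`, fixed by `dζ/(2η) = dX/(2Y)`. -/
def YMap (ρ : ℝ) (α β ζ η : ℂ) : ℂ := η * deriv (XMap ρ α β) ζ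

/-- `X_∞`, the limit of `X_ζ` as `ζ → ∞`. -/
def XInf (ρ : ℝ) (α β : ℂ) : ℂ :=
  e3 ρ α β + (e1 ρ α β - e3 ρ α β) * ((-1 / conj α - β) / (-1 / conj α - α))

/-- `Y_∞`, with its sign fixed by the square root `s = √z` through
`(X_∞ - X₀)/Y_∞ = -1/(β√z)`. This is the limit of `YMap` as `ζ → ∞` along the sheet `η ∼ s ζ²`. -/
def YInf (ρ : ℝ) (α β s : ℂ) : ℂ := -(β * s * (XInf ρ α β - XMap ρ α β 0))

/-- `t ↦ (γ t, y t)`, `a ≤ t ≤ b`, is a contour on the affine curve `η² = ζ² η⁽⁴⁾(ζ)`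
(so `y / γ` is the branch of `√η⁽⁴⁾` along it) and `u` is its lift to the Jacobian: `u` is
piecewise smooth and `X = ℘(u)`, `2Y = ℘'(u)` along the contour. The point `ζ = β`
corresponds to `X = ∞`, i.e. to `u ∈ Λ`. -/
structure IsContour (x ρ : ℝ) (v z α β : ℂ) (L : PeriodPair) (a b : ℝ) (γ y u : ℝ → ℂ) :
    Prop where
  le : a ≤ b
  continuousOn : ContinuousOn u (Set.Icc a b)
  differentiable : ∃ S : Set ℝ, S.Countable ∧ ∀ t ∈ Set.Ioo a b \ S, DifferentiableAt ℝ u t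
  integrable_deriv : IntervalIntegrable (deriv u) MeasureTheory.volume a b
  on_curve : ∀ t ∈ Set.Icc a b, y t ^ 2 = quartic x v z (γ t)
  lift : ∀ t ∈ Set.Icc a b, (γ t = β ∧ u t ∈ L.lattice) ∨
    (γ t ≠ β ∧ L.HasCoord (XMap ρ α β (γ t)) (YMap ρ α β (γ t) (y t)) (u t))

/-- The integrand of `I_m` along the contour: `dζ/ζ · ζᵐ/(2√η⁽⁴⁾) = ζᵐ dζ/(2η)` since
`η = ζ√η⁽⁴⁾`. -/
def integrand (m : ℕ) (γ y : ℝ → ℂ) (t : ℝ) : ℂ :=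
  γ t ^ m / (2 * y t) * deriv γ t

/-- The contour integral `I_m = ∫_Γ dζ/ζ · ζᵐ/(2√η⁽⁴⁾)`. -/
def I (m : ℕ) (γ y : ℝ → ℂ) (a b : ℝ) : ℂ := ∫ t in a..b, integrand m γ y t

/-- `x₊ = (x + 6|z|)/3`. -/
def xPlus (x : ℝ) (z : ℂ) : ℂ := ((x : ℂ) + 6 * (‖z‖ : ℂ)) / 3

/-- `x₋ = (x - 6|z|)/3`. -/
def xMinus (x : ℝ) (z : ℂ) : ℂ := ((x : ℂ) - 6 * (‖z‖ : ℂ)) / 3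

/-- The value claimed for `I₁` over `Γᵢ`, `(πᵢ(x₊) + πᵢ(x₋))/√z`, where `s = √z` and `up`, `um`
are the Jacobian coordinates of the points over `x₊`, `x₋`. -/
def complete1 (L : PeriodPair) (i : Fin 3) (s up um : ℂ) : ℂ :=
  1 / s * (L.thirdKind i up + L.thirdKind i um)

/-- The value claimed for `I₂` over `Γᵢ`,
`-1/(2z) [2ηᵢ + (x₊ + x₋) ωᵢ - v/√z (πᵢ(x₊) + πᵢ(x₋))]`. -/
def complete2 (L : PeriodPair) (i : Fin 3) (x : ℝ) (v z s up um : ℂ) : ℂ :=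
  -(1 / (2 * z)) * (2 * L.quasiHalfPeriod i + (xPlus x z + xMinus x z) * L.halfPeriod i
    - v / s * (L.thirdKind i up + L.thirdKind i um))

end O4

end

/-! Write `w` for `u_∞`. Everything comes from one elliptic function, `zetaKernel`, `K(u) = ζ_W(u -
w) - ζ_W(u + w) + 2ζ_W(w)`, and Liouville's identity `K(u) = ℘'(w)/(℘(u) - ℘(w))`
(`sub_mul_zetaKernel`). Since `X_ζ` is a Möbius function of `ζ` with pole `β` and value `℘(w)` at
infinity, the identity says `ζ = β - K(u)/(2√z)`. With `dζ/(2η) = du` the integrals become `∫ ζᵐ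
du`.

For `m = 1` the primitive of `K` is the logarithm of a sigma quotient plus a linear term. For `m =
2`, differentiating the identity in `u` and in `w` gives the difference and the sum of `℘(u ± w)`;
the sum is `4zζ² - 2vζ + 2x/3`, so `ζ²` is a combination of `ζ`, a constant and the derivative of
`ζ_W(u - w) + ζ_W(u + w)`. At `ζ = 0` the same formulas give `℘(w ± u₀) = x_±` and `ζ_W(w + u₀) +
ζ_W(w - u₀) = 2ζ_W(w) - 2√z β`, which eliminates `β`.

Over a period the quasi-periodicity of `σ` multiplies the quotient by `exp(-4ηᵢw)`, which fixes the
logarithm modulo `2πi` (`exists_I_one_eq_complete1`). For the straight contours the integer is zero: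
`℘(c + 2tωᵢ + τw)` is regular for `0 ≤ t ≤ 1`, `-1 ≤ τ ≤ 1` when `|q| < 1`, and integrating it in
both orders gives the exact value (`integral_weierstrassZeta_sub`). -/

open Filter Topology ComplexConjugate

namespace PeriodPair

variable (L : PeriodPair)

/-! ### The Weierstrass zeta function: derivative and quasi-periods. -/

section Zeta

theorem one_div_sub_add_eq {s l : ℂ} (hl : l ≠ 0) (hs : s ≠ l) :
    1 / (s - l) + 1 / l + s / l ^ 2 = s ^ 2 / (l ^ 2 * (s - l)) := by
  have := sub_ne_zero.mpr hs
  field_simp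
  ring

/-- Far from the disc, `‖s - l‖ ≥ ‖l‖/2`, so the term is `O(‖l‖⁻³)`, which is summable over a
lattice of rank two. -/
theorem weierstrassZeta_bound (r : ℝ) (hr : 0 < r) (s : ℂ) (hs : ‖s‖ < r) (l : ℂ)
    (h : 2 * r ≤ ‖l‖) :
    ‖1 / (s - l) + 1 / l + s / l ^ 2‖ ≤ 2 * r ^ 2 * ‖l‖ ^ (-3 : ℝ) := by
  have hsl : s ≠ l := by rintro rfl; linarith
  have hl : 0 < ‖l‖ := by linarith
  rw [one_div_sub_add_eq (norm_pos_iff.mp hl) hsl, norm_div, norm_mul, norm_pow, norm_pow]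
  have h1 : ‖l‖ / 2 ≤ ‖s - l‖ := by
    rw [norm_sub_rev]
    exact le_trans (by linarith) (norm_sub_norm_le l s)
  calc ‖s‖ ^ 2 / (‖l‖ ^ 2 * ‖s - l‖) ≤ r ^ 2 / (‖l‖ ^ 2 * (‖l‖ / 2)) := by gcongr
    _ = 2 * r ^ 2 / ‖l‖ ^ 3 := by field_simp
    _ = 2 * r ^ 2 * ‖l‖ ^ (-3 : ℝ) := by
      rw [Real.rpow_neg hl.le, div_eq_mul_inv]
      norm_cast

/-- The Weierstrass zeta function with the `l₀`-term missing. -/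
noncomputable def weierstrassZetaExcept (l₀ : ℂ) (u : ℂ) : ℂ :=
  ∑' l : L.lattice, if l.1 = l₀ then 0 else (1 / (u - l) + 1 / (l : ℂ) + u / (l : ℂ) ^ 2)

theorem hasSumLocallyUniformly_weierstrassZetaExcept (l₀ : ℂ) :
    HasSumLocallyUniformly
      (fun (l : L.lattice) (u : ℂ) ↦
        if l.1 = l₀ then 0 else (1 / (u - l) + 1 / (l : ℂ) + u / (l : ℂ) ^ 2))
      (L.weierstrassZetaExcept l₀) := by
  refine L.hasSumLocallyUniformly_aux (u := fun r l ↦ 2 * r ^ 2 * ‖l‖ ^ (-3 : ℝ)) _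
    (fun _ _ ↦ (ZLattice.summable_norm_rpow _ _ (by simp; norm_num)).mul_left _) fun r hr ↦
    Filter.eventually_atTop.mpr ⟨2 * r, ?_⟩
  rintro _ h s hs l rfl
  split_ifs
  · simp only [norm_zero]; positivity
  · exact weierstrassZeta_bound r hr s hs l h

theorem sub_ne_zero_of_mem_compl_sdiff {l₀ u : ℂ} (hu : u ∈ ((L.lattice : Set ℂ) \ {l₀})ᶜ)
    {l : L.lattice} (hl : l.1 ≠ l₀) : u - l ≠ 0 := fun e ↦ hl (by
  obtain rfl := sub_eq_zero.mp e
  simpa using hu)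

/-- Locally uniform convergence allows termwise differentiation; the differentiated series is that
of `-℘`. -/
theorem hasDerivAt_weierstrassZetaExcept (l₀ : ℂ) {u : ℂ}
    (hu : u ∈ ((L.lattice : Set ℂ) \ {l₀})ᶜ) :
    HasDerivAt (L.weierstrassZetaExcept l₀) (-L.weierstrassPExcept l₀ u) u := by
  have hterm : ∀ v ∈ ((L.lattice : Set ℂ) \ {l₀})ᶜ, ∀ l : L.lattice, HasDerivAt
      (fun u : ℂ ↦ if l.1 = l₀ then 0 else (1 / (u - l) + 1 / (l : ℂ) + u / (l : ℂ) ^ 2))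
      (if l.1 = l₀ then 0 else -(1 / (v - l) ^ 2 - 1 / (l : ℂ) ^ 2)) v := by
    intro v hv l
    split_ifs with hl
    · exact hasDerivAt_const _ _
    · have h0 := L.sub_ne_zero_of_mem_compl_sdiff hv hl
      have h1 : HasDerivAt (fun u : ℂ ↦ u - (l : ℂ)) 1 v := (hasDerivAt_id v).sub_const _
      have h2 := ((h1.fun_inv h0).add_const (1 / (l : ℂ))).add
        ((hasDerivAt_id v).div_const ((l : ℂ) ^ 2))
      convert! h2 using 1
      · ext; simp
      · ring
  have hS := (L.hasSumLocallyUniformly_weierstrassZetaExcept l₀)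
  have hS' : TendstoLocallyUniformlyOn
      (fun (s : Finset L.lattice) (u : ℂ) ↦ ∑ l ∈ s,
        if l.1 = l₀ then 0 else (1 / (u - l) + 1 / (l : ℂ) + u / (l : ℂ) ^ 2))
      (L.weierstrassZetaExcept l₀) atTop ((L.lattice : Set ℂ) \ {l₀})ᶜ :=
    hS.tendstoLocallyUniformlyOn
  have hd : ∀ᶠ s : Finset L.lattice in atTop, DifferentiableOn ℂ (fun u : ℂ ↦ ∑ l ∈ s,
        if l.1 = l₀ then 0 else (1 / (u - l) + 1 / (l : ℂ) + u / (l : ℂ) ^ 2))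
        ((L.lattice : Set ℂ) \ {l₀})ᶜ :=
    .of_forall fun s v hv ↦
      (HasDerivAt.fun_sum fun l _ ↦ hterm v hv l).differentiableAt.differentiableWithinAt
  have hdiff := (hS'.differentiableOn hd L.isOpen_compl_lattice_sdiff).differentiableAt
    (L.isOpen_compl_lattice_sdiff.mem_nhds hu)
  have hlim := (hS'.deriv hd L.isOpen_compl_lattice_sdiff).tendsto_at hu
  have hlim' : Tendsto (fun s : Finset L.lattice ↦ ∑ l ∈ s,
      if l.1 = l₀ then 0 else -(1 / (u - l) ^ 2 - 1 / (l : ℂ) ^ 2)) atTop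
      (𝓝 (-L.weierstrassPExcept l₀ u)) := by
    have h := (L.hasSum_weierstrassPExcept l₀ u).neg
    have h' : HasSum (fun l : L.lattice ↦
      if l.1 = l₀ then 0 else -(1 / (u - l) ^ 2 - 1 / (l : ℂ) ^ 2))
      (-L.weierstrassPExcept l₀ u) := by
      convert! h using 2
      split_ifs <;> simp
    exact h'
  have heq := tendsto_nhds_unique hlim (hlim'.congr fun s ↦
    ((HasDerivAt.fun_sum fun l _ ↦ hterm u hu l).deriv).symm)
  rw [← heq]
  exact hdiff.hasDerivAt

theorem weierstrassZetaExcept_add (l₀ : L.lattice) (u : ℂ) :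
    L.weierstrassZetaExcept l₀ u + (1 / (u - l₀) + 1 / (l₀ : ℂ) + u / (l₀ : ℂ) ^ 2)
      = L.weierstrassZeta u := by
  trans L.weierstrassZetaExcept l₀ u +
    ∑' i : L.lattice, if i = l₀.1 then (1 / (u - l₀.1) + 1 / (l₀ : ℂ) + u / (l₀ : ℂ) ^ 2) else 0
  · simp
  rw [weierstrassZetaExcept, ← Summable.tsum_add]
  · congr with w; split_ifs <;> simp_all
  · exact (L.hasSumLocallyUniformly_weierstrassZetaExcept _).hasSum.summable
  · exact summable_of_hasFiniteSupport ((Set.finite_singleton l₀).subset (by simp_all))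

theorem weierstrassZetaExcept_of_notMem (l₀ : ℂ) (hl : l₀ ∉ L.lattice) :
    L.weierstrassZetaExcept l₀ = L.weierstrassZeta := by
  delta weierstrassZetaExcept weierstrassZeta
  congr! 3 with z l
  have : l.1 ≠ l₀ := by rintro rfl; simp at hl
  simp [this]

theorem hasSum_weierstrassZeta (u : ℂ) :
    HasSum (fun l : L.lattice ↦ (1 / (u - l) + 1 / (l : ℂ) + u / (l : ℂ) ^ 2))
      (L.weierstrassZeta u) := by
  -- The excepted point `ω₁/2` is not in the lattice, so no term is dropped.
  have h := (L.hasSumLocallyUniformly_weierstrassZetaExcept (L.ω₁ / 2)).hasSum (x := u)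
  rw [L.weierstrassZetaExcept_of_notMem _ L.ω₁_div_two_notMem_lattice] at h
  convert! h using 2 with l
  rw [if_neg]; exact fun e ↦ L.ω₁_div_two_notMem_lattice (e ▸ l.2)

theorem hasDerivAt_weierstrassZeta {u : ℂ} (hu : u ∉ L.lattice) :
    HasDerivAt L.weierstrassZeta (-L.weierstrassP u) u := by
  have h := L.hasDerivAt_weierstrassZetaExcept (L.ω₁ / 2) (u := u) (by simp [hu])
  rwa [L.weierstrassZetaExcept_of_notMem _ L.ω₁_div_two_notMem_lattice,
    L.weierstrassPExcept_of_notMem _ L.ω₁_div_two_notMem_lattice] at h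

theorem hasDerivAt_weierstrassP {u : ℂ} (hu : u ∉ L.lattice) :
    HasDerivAt L.weierstrassP (L.derivWeierstrassP u) u := by
  rw [← L.deriv_weierstrassP]
  exact (L.differentiableOn_weierstrassP.differentiableAt
    (L.isClosed_lattice.isOpen_compl.mem_nhds hu)).hasDerivAt

@[simp]
theorem weierstrassZeta_neg (u : ℂ) : L.weierstrassZeta (-u) = -L.weierstrassZeta u := by
  simp only [weierstrassZeta]
  rw [← (Equiv.neg L.lattice).tsum_eq, ← tsum_neg]
  congr with l
  have : -u - -(l : ℂ) = -(u - l) := by ring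
  simp only [Equiv.neg_apply, NegMemClass.coe_neg, this, one_div, inv_neg, neg_div, even_two,
    Even.neg_pow]
  ring

theorem isPreconnected_compl_lattice : IsPreconnected ((L.lattice : Set ℂ)ᶜ) := by
  refine (Set.Countable.isConnected_compl_of_one_lt_rank ?_ ?_).isPreconnected
  · rw [Complex.rank_real_complex]
    exact_mod_cast Nat.one_lt_two
  · have : Countable L.lattice := L.latticeEquivProd.toEquiv.countable_iff.mpr inferInstance
    exact Set.to_countable _

theorem isOpen_compl_lattice : IsOpen ((L.lattice : Set ℂ)ᶜ) := L.isClosed_lattice.isOpen_compl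

variable {L} in
theorem add_mem_lattice_iff {u l : ℂ} (hl : l ∈ L.lattice) :
    u + l ∈ L.lattice ↔ u ∈ L.lattice := Submodule.add_mem_iff_left _ hl

/-- The difference has derivative zero because `℘` is periodic, and the complement of the lattice is
connected. -/
theorem exists_weierstrassZeta_add {l : ℂ} (hl : l ∈ L.lattice) :
    ∃ c, ∀ u ∉ L.lattice, L.weierstrassZeta (u + l) = L.weierstrassZeta u + c := by
  have hd : ∀ u ∈ (L.lattice : Set ℂ)ᶜ,
      HasDerivAt (fun u ↦ L.weierstrassZeta (u + l) - L.weierstrassZeta u) 0 u := by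
    intro u hu
    have h1 := (L.hasDerivAt_weierstrassZeta
      (mt (add_mem_lattice_iff hl).mp hu)).comp_add_const u l
    convert! h1.sub (L.hasDerivAt_weierstrassZeta hu) using 1
    rw [L.weierstrassP_add_coe u ⟨l, hl⟩]
    ring
  obtain ⟨c, hc⟩ := L.isOpen_compl_lattice.exists_is_const_of_deriv_eq_zero
    L.isPreconnected_compl_lattice
    (fun u hu ↦ (hd u hu).differentiableAt.differentiableWithinAt) (fun u hu ↦ (hd u hu).deriv)
  exact ⟨c, fun u hu ↦ by rw [← hc u hu]; ring⟩

/-- The additive constant is read off at `u = -w`, where oddness gives `2ζ(w)`. -/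
theorem weierstrassZeta_add_two_mul {w u : ℂ} (hw : w ∉ L.lattice) (hw2 : 2 * w ∈ L.lattice)
    (hu : u ∉ L.lattice) :
    L.weierstrassZeta (u + 2 * w) = L.weierstrassZeta u + 2 * L.weierstrassZeta w := by
  obtain ⟨c, hc⟩ := L.exists_weierstrassZeta_add hw2
  have h := hc (-w) (by simpa using hw)
  rw [show -w + 2 * w = w by ring, weierstrassZeta_neg] at h
  rw [hc u hu]
  linear_combination -h

end Zeta

/-! ### The Weierstrass sigma function: logarithmic derivative and quasi-periodicity. -/

section Sigma

/-- The exponential cancels the Taylor polynomial of `log (1 - w)` of degree two, leaving a cubic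
remainder; then `|e^r - 1| ≤ 2|r|` for `|r| ≤ 1`. -/
theorem norm_one_sub_mul_exp_sub_one_le {w : ℂ} (hw : ‖w‖ ≤ 1 / 2) :
    ‖(1 - w) * Complex.exp (w + w ^ 2 / 2) - 1‖ ≤ 4 * ‖w‖ ^ 3 := by
  have hne : (1 : ℂ) - w ≠ 0 := by
    intro h
    have : w = 1 := by linear_combination -h
    rw [this] at hw
    norm_num at hw
  have h1 := Complex.norm_log_sub_logTaylor_le 2 (z := -w) (by rw [norm_neg]; linarith)
  have h2 : Complex.log (1 + -w) - Complex.logTaylor 3 (-w)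
      = Complex.log (1 - w) + (w + w ^ 2 / 2) := by
    simp [Complex.logTaylor, Finset.sum_range_succ, ← sub_eq_add_neg]
    ring
  rw [h2, norm_neg] at h1
  have h3 : (1 - ‖w‖)⁻¹ ≤ 2 := by
    rw [inv_le_comm₀ (by linarith) (by norm_num)]
    linarith
  have h4 : ‖Complex.log (1 - w) + (w + w ^ 2 / 2)‖ ≤ 2 * ‖w‖ ^ 3 := by
    refine h1.trans ?_
    have h5 : 0 ≤ ‖w‖ ^ 3 := by positivity
    norm_num
    nlinarith [mul_le_mul_of_nonneg_left h3 h5]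
  have h6 : 2 * ‖w‖ ^ 3 ≤ 1 := by
    have : ‖w‖ ^ 3 ≤ (1 / 2) ^ 3 := by gcongr
    linarith
  have h7 := Complex.norm_exp_sub_one_le (h4.trans h6)
  rw [Complex.exp_add, Complex.exp_log hne] at h7
  linarith

/-- The factor of the sigma product that belongs to the lattice point `l`. -/
noncomputable def sigmaFactor (l u : ℂ) : ℂ :=
  (1 - u / l) * Complex.exp (u / l + u ^ 2 / (2 * l ^ 2))

theorem sigmaFactor_ne_zero {l u : ℂ} (hl : l ≠ 0) (h : u ≠ l) : sigmaFactor l u ≠ 0 := by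
  refine mul_ne_zero ?_ (Complex.exp_ne_zero _)
  rw [sub_ne_zero]
  intro e
  exact h ((div_eq_one_iff_eq hl).mp e.symm)

theorem hasDerivAt_sigmaFactor {l u : ℂ} (hl : l ≠ 0) (h : u ≠ l) :
    HasDerivAt (sigmaFactor l) ((1 / (u - l) + 1 / l + u / l ^ 2) * sigmaFactor l u) u := by
  have hsub := sub_ne_zero.mpr h
  have h1 : HasDerivAt (fun u : ℂ ↦ 1 - u / l) (-(1 / l)) u :=
    ((hasDerivAt_id u).div_const l).const_sub 1
  have h2 : HasDerivAt (fun u : ℂ ↦ u / l + u ^ 2 / (2 * l ^ 2)) (1 / l + u / l ^ 2) u := by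
    convert! ((hasDerivAt_id u).div_const l).add (((hasDerivAt_id u).pow 2).div_const (2 * l ^ 2))
      using 1
    simp
    field_simp
  refine (h1.mul h2.cexp).congr_deriv ?_
  unfold sigmaFactor
  field_simp
  ring

theorem differentiable_sigmaFactor (l : ℂ) : Differentiable ℂ (sigmaFactor l) := by
  unfold sigmaFactor
  fun_prop

theorem norm_sigmaFactor_sub_one_le {r : ℝ} {l u : ℂ} (hr : 0 < r) (hu : ‖u‖ < r)
    (hl : 2 * r ≤ ‖l‖) : ‖sigmaFactor l u - 1‖ ≤ 4 * r ^ 3 * ‖l‖ ^ (-3 : ℝ) := by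
  have hl0 : 0 < ‖l‖ := by linarith
  have h := norm_one_sub_mul_exp_sub_one_le (w := u / l) (by
    rw [norm_div, div_le_iff₀ hl0]; linarith)
  have e : u / l + (u / l) ^ 2 / 2 = u / l + u ^ 2 / (2 * l ^ 2) := by ring
  rw [e] at h
  refine h.trans ?_
  rw [norm_div, div_pow, Real.rpow_neg hl0.le, ← div_eq_mul_inv, ← mul_div_assoc]
  norm_cast
  gcongr

theorem summable_norm_lattice_ne_zero :
    Summable fun l : {l : L.lattice // l ≠ 0} ↦ ‖(l.1 : ℂ)‖ ^ (-3 : ℝ) :=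
  (ZLattice.summable_norm_rpow L.lattice (-3) (by simp; norm_num)).subtype _

theorem eventually_norm_sigmaFactor_sub_one_le {r : ℝ} (hr : 0 < r) :
    ∀ᶠ l : {l : L.lattice // l ≠ 0} in cofinite, ∀ u ∈ Metric.ball (0 : ℂ) r,
      ‖sigmaFactor l.1 u - 1‖ ≤ 4 * r ^ 3 * ‖(l.1 : ℂ)‖ ^ (-3 : ℝ) := by
  have hfin : {l : L.lattice | ‖l‖ < 2 * r}.Finite :=
    (isCompact_iff_finite.mp (isCompact_closedBall (0 : L.lattice) (2 * r))).subset
      fun l hl ↦ by simpa using! hl.le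
  have h : ∀ᶠ l : L.lattice in cofinite, 2 * r ≤ ‖l‖ := by
    rw [eventually_cofinite]
    simpa using! hfin
  filter_upwards [Subtype.val_injective.tendsto_cofinite.eventually h] with l hl u hu
  exact norm_sigmaFactor_sub_one_le hr (by simpa using hu) hl

theorem multipliableLocallyUniformlyOn_sigmaFactor {r : ℝ} (hr : 0 < r) :
    MultipliableLocallyUniformlyOn
      (fun (l : {l : L.lattice // l ≠ 0}) u ↦ sigmaFactor l.1 u) (Metric.ball (0 : ℂ) r) := by
  have h := Summable.multipliableLocallyUniformlyOn_one_add
    (f := fun (l : {l : L.lattice // l ≠ 0}) u ↦ sigmaFactor l.1 u - 1)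
    Metric.isOpen_ball (L.summable_norm_lattice_ne_zero.mul_left (4 * r ^ 3))
    (L.eventually_norm_sigmaFactor_sub_one_le hr)
    (fun l ↦ ((differentiable_sigmaFactor _).continuous.sub continuous_const).continuousOn)
  simpa using h

theorem tprod_sigmaFactor_ne_zero {u : ℂ} (hu : ∀ l : L.lattice, l ≠ 0 → u ≠ l) :
    ∏' l : {l : L.lattice // l ≠ 0}, sigmaFactor l.1 u ≠ 0 := by
  have hr : 0 < ‖u‖ + 1 := by positivity
  have h := tprod_one_add_ne_zero_of_summable
    (f := fun (l : {l : L.lattice // l ≠ 0}) ↦ sigmaFactor l.1 u - 1)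
    (fun l ↦ by simpa using sigmaFactor_ne_zero (by simpa using l.2) (hu l.1 l.2))
    (Summable.of_norm_bounded_eventually
      (L.summable_norm_lattice_ne_zero.mul_left (4 * (‖u‖ + 1) ^ 3)) (by
        filter_upwards [L.eventually_norm_sigmaFactor_sub_one_le hr] with l hl
        simpa using hl u (by simp)))
  simpa using h

theorem weierstrassSigma_ne_zero {u : ℂ} (hu : u ∉ L.lattice) : L.weierstrassSigma u ≠ 0 := by
  refine mul_ne_zero ?_ (L.tprod_sigmaFactor_ne_zero ?_)
  · rintro rfl; exact hu (zero_mem _)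
  · rintro l - rfl; exact hu l.2

/-- The logarithmic derivative of the product is taken factor by factor; the prefactor `u` supplies
the term `1/u` of zeta. -/
theorem hasDerivAt_weierstrassSigma {u : ℂ} (hu : u ∉ L.lattice) :
    HasDerivAt L.weierstrassSigma (L.weierstrassZeta u * L.weierstrassSigma u) u := by
  have hr : 0 < ‖u‖ + 1 := by positivity
  have hmem : u ∈ Metric.ball (0 : ℂ) (‖u‖ + 1) := by simp
  have hu' : ∀ l : L.lattice, l ≠ 0 → u ≠ l := by rintro l - rfl; exact hu l.2
  have hu0 : u ≠ 0 := by rintro rfl; exact hu (zero_mem _)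
  have hm := L.multipliableLocallyUniformlyOn_sigmaFactor hr
  have hnz := L.tprod_sigmaFactor_ne_zero hu'
  have hld : ∀ l : {l : L.lattice // l ≠ 0}, logDeriv (sigmaFactor l.1) u
      = 1 / (u - (l.1 : ℂ)) + 1 / (l.1 : ℂ) + u / (l.1 : ℂ) ^ 2 := by
    intro l
    have hl : (l.1 : ℂ) ≠ 0 := by simpa using l.2
    rw [logDeriv_apply, (hasDerivAt_sigmaFactor hl (hu' _ l.2)).deriv,
      mul_div_cancel_right₀ _ (sigmaFactor_ne_zero hl (hu' _ l.2))]
  have hz := L.hasSum_weierstrassZeta u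
  have hlog := logDeriv_tprod_eq_tsum Metric.isOpen_ball hmem
    (f := fun (l : {l : L.lattice // l ≠ 0}) u ↦ sigmaFactor l.1 u)
    (fun l ↦ sigmaFactor_ne_zero (by simpa using l.2) (hu' _ l.2))
    (fun l ↦ (differentiable_sigmaFactor _).differentiableOn)
    (by
      refine Summable.congr ?_ fun l ↦ (hld l).symm
      exact hz.summable.subtype _) hm hnz
  have hsum : L.weierstrassZeta u = 1 / u +
      ∑' l : {l : L.lattice // l ≠ 0}, (1 / (u - (l.1 : ℂ)) + 1 / (l.1 : ℂ)
        + u / (l.1 : ℂ) ^ 2) := by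
    rw [← hz.tsum_eq]
    have := hz.summable.tsum_subtype_add_tsum_subtype_compl {0}
    rw [← this, tsum_singleton (0 : L.lattice)
      (fun l : L.lattice ↦ (1 / (u - l) + 1 / (l : ℂ) + u / (l : ℂ) ^ 2))]
    simp
    rfl
  have hdiff : DifferentiableAt ℂ (fun u ↦ ∏' l : {l : L.lattice // l ≠ 0}, sigmaFactor l.1 u) u :=
    (hm.hasProdLocallyUniformlyOn.differentiableOn
      (.of_forall fun _ ↦ by
        simpa [Finset.prod_fn] using DifferentiableOn.finsetProd
          (fun _ _ ↦ (differentiable_sigmaFactor _).differentiableOn))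
      Metric.isOpen_ball).differentiableAt (Metric.isOpen_ball.mem_nhds hmem)
  rw [logDeriv_apply, div_eq_iff hnz] at hlog
  have h := (hasDerivAt_id u).mul (hdiff.hasDerivAt)
  refine h.congr_deriv ?_
  rw [hlog, hsum]
  simp_rw [hld]
  change _ = _ * (u * ∏' l : {l : L.lattice // l ≠ 0}, sigmaFactor l.1 u)
  simp only [id]
  field_simp

theorem weierstrassSigma_neg (u : ℂ) : L.weierstrassSigma (-u) = -L.weierstrassSigma u := by
  have e : ∏' l : {l : L.lattice // l ≠ 0}, sigmaFactor l.1 (-u)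
      = ∏' l : {l : L.lattice // l ≠ 0}, sigmaFactor l.1 u := by
    rw [← ((Equiv.neg L.lattice).subtypeEquiv (p := (· ≠ 0)) (q := (· ≠ 0))
      (fun l ↦ by simp)).tprod_eq]
    congr with l
    simp [sigmaFactor]
  change -u * ∏' l : {l : L.lattice // l ≠ 0}, sigmaFactor l.1 (-u)
    = -(u * ∏' l : {l : L.lattice // l ≠ 0}, sigmaFactor l.1 u)
  rw [e]
  ring

/-- The quotient of the two sides is locally constant by the quasi-periodicity of zeta; its value at
`u = -w` is found from the oddness of sigma. -/
theorem weierstrassSigma_add_two_mul {w u : ℂ} (hw : w ∉ L.lattice) (hw2 : 2 * w ∈ L.lattice)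
    (hu : u ∉ L.lattice) :
    L.weierstrassSigma (u + 2 * w)
      = -Complex.exp (2 * L.weierstrassZeta w * (u + w)) * L.weierstrassSigma u := by
  have hd : ∀ u ∈ (L.lattice : Set ℂ)ᶜ, HasDerivAt (fun u ↦ L.weierstrassSigma (u + 2 * w)
      * Complex.exp (-(2 * L.weierstrassZeta w * (u + w))) / L.weierstrassSigma u) 0 u := by
    intro u hu
    have h1 := (L.hasDerivAt_weierstrassSigma
      (mt (add_mem_lattice_iff hw2).mp hu)).comp_add_const u (2 * w)
    have h2 : HasDerivAt (fun u ↦ -(2 * L.weierstrassZeta w * (u + w)))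
        (-(2 * L.weierstrassZeta w)) u := by
      simpa using (((hasDerivAt_id u).add_const w).const_mul (2 * L.weierstrassZeta w)).fun_neg
    have hσ := L.weierstrassSigma_ne_zero hu
    refine ((h1.fun_mul h2.cexp).fun_div (L.hasDerivAt_weierstrassSigma hu) hσ).congr_deriv ?_
    rw [L.weierstrassZeta_add_two_mul hw hw2 hu]
    field_simp
    ring
  obtain ⟨c, hc⟩ := L.isOpen_compl_lattice.exists_is_const_of_deriv_eq_zero
    L.isPreconnected_compl_lattice
    (fun u hu ↦ (hd u hu).differentiableAt.differentiableWithinAt) (fun u hu ↦ (hd u hu).deriv)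
  have hw' : -w ∉ L.lattice := by simpa using hw
  have h := hc (-w) hw'
  have hσ := L.weierstrassSigma_ne_zero hw
  rw [show -w + 2 * w = w by ring, weierstrassSigma_neg] at h
  simp only [neg_add_cancel, mul_zero, neg_zero, Complex.exp_zero, mul_one, div_neg,
    div_self hσ] at h
  have h' := hc u hu
  have hσu := L.weierstrassSigma_ne_zero hu
  rw [← h, Complex.exp_neg] at h'
  have hexp := Complex.exp_ne_zero (2 * L.weierstrassZeta w * (u + w))
  field_simp at h'
  linear_combination h'

end Sigma

/-! ### Liouville's theorem for periodic functions. -/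

section Liouville

theorem eventually_add_notMem_lattice (a x : ℂ) : ∀ᶠ u in 𝓝[≠] x, u + a ∉ L.lattice := by
  have h := L.compl_lattice_sdiff_singleton_mem_nhds (x + a)
  have h' : ∀ᶠ u in 𝓝 x, u + a ∈ ((L.lattice : Set ℂ) \ {x + a})ᶜ :=
    (continuous_add_const a).continuousAt.eventually h
  filter_upwards [mem_nhdsWithin_of_mem_nhds h', self_mem_nhdsWithin] with u hu hux hmem
  exact hu ⟨hmem, fun e ↦ hux (add_right_cancel e)⟩

theorem eventually_add_notMem_lattice_of_notMem {a x : ℂ} (h : x + a ∉ L.lattice) :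
    ∀ᶠ u in 𝓝 x, u + a ∉ L.lattice :=
  (continuous_add_const a).continuousAt.eventually (L.isOpen_compl_lattice.mem_nhds h)

/-- Continuity removes the isolated singularities, and periodicity with a compact quotient gives
boundedness. -/
theorem eq_of_periodic_of_continuous {f : ℂ → ℂ} (hc : Continuous f)
    (hd : ∀ x, ∀ᶠ z in 𝓝[≠] x, DifferentiableAt ℂ f z)
    (hp : ∀ z, ∀ l ∈ L.lattice, f (z + l) = f z) (x y : ℂ) : f x = f y := by
  have hf : Differentiable ℂ f := fun z ↦
    (Complex.analyticAt_of_differentiable_on_punctured_nhds_of_continuousAt (hd z)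
      hc.continuousAt).differentiableAt
  exact hf.apply_eq_apply_of_bounded
    (IsZLattice.isCompact_range_of_periodic L.lattice _ hc hp).isBounded x y

end Liouville

/-! ### The kernel with simple poles at `± w`. -/

section Kernel

/-- The elliptic function `ζ(u - w) - ζ(u + w) + 2ζ(w)` of `u`, with simple poles at `± w`. -/
noncomputable def zetaKernel (w u : ℂ) : ℂ :=
  L.weierstrassZeta (u - w) - L.weierstrassZeta (u + w) + 2 * L.weierstrassZeta w

theorem zetaKernel_neg (w u : ℂ) : L.zetaKernel w (-u) = L.zetaKernel w u := by
  unfold zetaKernel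
  rw [show -u - w = -(u + w) by ring, show -u + w = -(u - w) by ring, weierstrassZeta_neg,
    weierstrassZeta_neg]
  ring

theorem zetaKernel_add {w u l : ℂ} (hl : l ∈ L.lattice) (h1 : u - w ∉ L.lattice)
    (h2 : u + w ∉ L.lattice) : L.zetaKernel w (u + l) = L.zetaKernel w u := by
  obtain ⟨c, hc⟩ := L.exists_weierstrassZeta_add hl
  unfold zetaKernel
  rw [show u + l - w = u - w + l by ring, show u + l + w = u + w + l by ring, hc _ h1, hc _ h2]
  ring

theorem zetaKernel_zero (w : ℂ) : L.zetaKernel w 0 = 0 := by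
  simp [zetaKernel]
  ring

theorem zetaKernel_of_mem {w u : ℂ} (hw : w ∉ L.lattice) (hu : u ∈ L.lattice) :
    L.zetaKernel w u = 0 := by
  rw [← zero_add u, L.zetaKernel_add hu (by simpa using hw) (by simpa using hw), zetaKernel_zero]

theorem hasDerivAt_zetaKernel {w u : ℂ} (h1 : u - w ∉ L.lattice) (h2 : u + w ∉ L.lattice) :
    HasDerivAt (L.zetaKernel w) (L.weierstrassP (u + w) - L.weierstrassP (u - w)) u := by
  have e1 := (L.hasDerivAt_weierstrassZeta h1).comp_sub_const u w
  have e2 := (L.hasDerivAt_weierstrassZeta h2).comp_add_const u w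
  exact ((e1.fun_sub e2).add_const _).congr_deriv (by ring)

theorem hasDerivAt_zetaKernel_left {w u : ℂ} (hw : w ∉ L.lattice) (h1 : u - w ∉ L.lattice)
    (h2 : u + w ∉ L.lattice) :
    HasDerivAt (fun w ↦ L.zetaKernel w u)
      (L.weierstrassP (u - w) + L.weierstrassP (u + w) - 2 * L.weierstrassP w) w := by
  have e1 := (L.hasDerivAt_weierstrassZeta h1).comp_const_sub u w
  have e2 := (L.hasDerivAt_weierstrassZeta h2).comp_const_add u w
  have e3 := (L.hasDerivAt_weierstrassZeta hw).const_mul 2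
  exact ((e1.fun_sub e2).fun_add e3).congr_deriv (by ring)

theorem tendsto_mul_weierstrassZeta_zero :
    Tendsto (fun v ↦ v * L.weierstrassZeta v) (𝓝[≠] 0) (𝓝 1) := by
  have h0 : (0 : ℂ) ∈ ((L.lattice : Set ℂ) \ {0})ᶜ := by simp
  have hc : ContinuousAt (fun v ↦ v * L.weierstrassZetaExcept 0 v + 1) 0 :=
    (continuousAt_id.mul (L.hasDerivAt_weierstrassZetaExcept 0 h0).continuousAt).add
      continuousAt_const
  have ht := hc.tendsto.mono_left (nhdsWithin_le_nhds (s := {0}ᶜ))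
  simp only [zero_mul, zero_add] at ht
  refine ht.congr' ?_
  filter_upwards [self_mem_nhdsWithin] with v hv
  have hv : v ≠ 0 := hv
  have h := L.weierstrassZetaExcept_add 0 v
  simp only [ZeroMemClass.coe_zero, sub_zero, div_zero, add_zero, ne_eq, OfNat.ofNat_ne_zero,
    not_false_eq_true, zero_pow] at h
  rw [← h]
  field_simp

/-- The kernel and its derivative `℘(w) - ℘(-w)` vanish at `0`, and this double zero cancels the
double pole of `℘`. The limit need not be known, since Liouville's theorem determines it later. -/
theorem exists_tendsto_mul_zetaKernel_zero {w : ℂ} (hw : w ∉ L.lattice) :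
    ∃ c, Tendsto (fun u ↦ (L.weierstrassP u - L.weierstrassP w) * L.zetaKernel w u)
      (𝓝[≠] 0) (𝓝 c) := by
  have hK : ∀ᶠ u in 𝓝 (0 : ℂ), HasDerivAt (L.zetaKernel w)
      (L.weierstrassP (u + w) - L.weierstrassP (u - w)) u := by
    filter_upwards [L.eventually_add_notMem_lattice_of_notMem (x := 0) (a := w) (by simpa using hw),
      L.eventually_add_notMem_lattice_of_notMem (x := 0) (a := -w) (by simpa using hw)]
      with u h1 h2
    exact L.hasDerivAt_zetaKernel (by rwa [sub_eq_add_neg]) h1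
  have hKa : AnalyticAt ℂ (L.zetaKernel w) 0 :=
    Complex.analyticAt_iff_eventually_differentiableAt.mpr (hK.mono fun u h ↦ h.differentiableAt)
  have hord : ((2 : ℕ) : ℕ∞) ≤ analyticOrderAt (L.zetaKernel w) 0 := by
    rw [natCast_le_analyticOrderAt_iff_iteratedDeriv_eq_zero hKa]
    intro i hi
    interval_cases i
    · simp [zetaKernel_zero]
    · rw [iteratedDeriv_one, hK.self_of_nhds.deriv]
      simp
  obtain ⟨g, hg, hgK⟩ := (natCast_le_analyticOrderAt hKa).mp hord
  refine ⟨g 0, ?_⟩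
  have hE : ContinuousAt (L.weierstrassPExcept 0) 0 :=
    (L.analyticAt_weierstrassPExcept 0).continuousAt
  have hc : ContinuousAt (fun u ↦ (u ^ 2 * L.weierstrassPExcept 0 u + 1) * g u
      - L.weierstrassP w * L.zetaKernel w u) 0 :=
    ((((continuousAt_id.pow 2).mul hE).add continuousAt_const).mul hg.continuousAt).sub
      (continuousAt_const.mul hKa.continuousAt)
  have ht := hc.tendsto.mono_left (nhdsWithin_le_nhds (s := {0}ᶜ))
  simp only [ne_eq, OfNat.ofNat_ne_zero, not_false_eq_true, zero_pow, zero_mul, zero_add, one_mul,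
    zetaKernel_zero, mul_zero, sub_zero] at ht
  refine ht.congr' ?_
  filter_upwards [self_mem_nhdsWithin, mem_nhdsWithin_of_mem_nhds hgK] with u hu hgu
  have hu : u ≠ 0 := hu
  have h := L.weierstrassPExcept_add 0 u
  simp only [ZeroMemClass.coe_zero, sub_zero, div_zero, ne_eq, OfNat.ofNat_ne_zero,
    not_false_eq_true, zero_pow] at h
  rw [sub_mul, ← h, hgu]
  simp only [sub_zero, smul_eq_mul]
  field_simp

/-- The slope of `℘` at `w` meets the residue `1` of `ζ(u - w)`; the other terms stay bounded
because `2w ∉ Λ` and are killed by `℘(u) - ℘(w)`. -/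
theorem tendsto_mul_zetaKernel_self {w : ℂ} (hw : w ∉ L.lattice) (hw2 : 2 * w ∉ L.lattice) :
    Tendsto (fun u ↦ (L.weierstrassP u - L.weierstrassP w) * L.zetaKernel w u)
      (𝓝[≠] w) (𝓝 (L.derivWeierstrassP w)) := by
  have hP := L.hasDerivAt_weierstrassP hw
  have h1 := hasDerivAt_iff_tendsto_slope.mp hP
  have hsub : Tendsto (fun u ↦ u - w) (𝓝[≠] w) (𝓝[≠] 0) := by
    refine tendsto_nhdsWithin_of_tendsto_nhds_of_eventually_within _ ?_ ?_
    · have : ContinuousAt (fun u : ℂ ↦ u - w) w := by fun_prop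
      simpa using this.tendsto.mono_left (nhdsWithin_le_nhds (s := {w}ᶜ))
    · filter_upwards [self_mem_nhdsWithin] with u hu
      exact sub_ne_zero.mpr hu
  have h2 := L.tendsto_mul_weierstrassZeta_zero.comp hsub
  have h3 : ContinuousAt (fun u ↦ (L.weierstrassP u - L.weierstrassP w) *
      (2 * L.weierstrassZeta w - L.weierstrassZeta (u + w))) w := by
    have := ((L.hasDerivAt_weierstrassZeta (u := w + w) (by
      rwa [← two_mul])).comp_add_const w w).continuousAt
    exact (hP.continuousAt.sub continuousAt_const).mul (continuousAt_const.sub this)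
  have h3' := h3.tendsto.mono_left (nhdsWithin_le_nhds (s := {w}ᶜ))
  have ht := (h1.mul h2).add h3'
  simp only [mul_one, sub_self, zero_mul, add_zero] at ht
  refine ht.congr' ?_
  filter_upwards [self_mem_nhdsWithin] with u hu
  have hu : u - w ≠ 0 := sub_ne_zero.mpr hu
  simp only [slope_def_field, Function.comp, zetaKernel]
  field_simp
  ring

theorem sub_mul_zetaKernel {w u : ℂ} (hw : w ∉ L.lattice) (hw2 : 2 * w ∉ L.lattice)
    (hu : u ∉ L.lattice) (h1 : u - w ∉ L.lattice) (h2 : u + w ∉ L.lattice) :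
    (L.weierstrassP u - L.weierstrassP w) * L.zetaKernel w u = L.derivWeierstrassP w := by
  classical
  obtain ⟨c, hc⟩ := L.exists_tendsto_mul_zetaKernel_zero hw
  set P : ℂ → ℂ := fun u ↦ (L.weierstrassP u - L.weierstrassP w) * L.zetaKernel w u with hPdef
  -- The product is extended by its limits: `c` at the lattice, `℘'(w)` at the translates of `± w`.
  set f : ℂ → ℂ := fun u ↦ if u ∈ L.lattice then c else
    if u - w ∈ L.lattice ∨ u + w ∈ L.lattice then L.derivWeierstrassP w else P u with hf
  have hfP : ∀ u, u ∉ L.lattice → u - w ∉ L.lattice → u + w ∉ L.lattice → f u = P u := by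
    intro u a b c
    simp [hf, a, b, c]
  have hev : ∀ x, ∀ᶠ u in 𝓝[≠] x, u ∉ L.lattice ∧ u - w ∉ L.lattice ∧ u + w ∉ L.lattice := by
    intro x
    filter_upwards [L.eventually_add_notMem_lattice 0 x, L.eventually_add_notMem_lattice (-w) x,
      L.eventually_add_notMem_lattice w x] with u a b c
    exact ⟨by simpa using a, by rwa [sub_eq_add_neg], c⟩
  have hdiff : ∀ u, u ∉ L.lattice → u - w ∉ L.lattice → u + w ∉ L.lattice →
      DifferentiableAt ℂ f u := by
    intro u a b c
    have hPd : DifferentiableAt ℂ P u :=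
      ((L.hasDerivAt_weierstrassP a).differentiableAt.sub_const _).mul
        (L.hasDerivAt_zetaKernel b c).differentiableAt
    refine hPd.congr_of_eventuallyEq ?_
    filter_upwards [L.eventually_add_notMem_lattice_of_notMem (x := u) (a := 0) (by simpa using a),
      L.eventually_add_notMem_lattice_of_notMem (x := u) (a := -w) (by rwa [← sub_eq_add_neg]),
      L.eventually_add_notMem_lattice_of_notMem (x := u) (a := w) c] with v a b c
    exact hfP v (by simpa using a) (by rwa [sub_eq_add_neg]) c
  have hlim : ∀ x, Tendsto P (𝓝[≠] x) (𝓝 (f x)) → ContinuousAt f x := by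
    intro x hx
    rw [continuousAt_iff_punctured_nhds]
    refine hx.congr' ?_
    filter_upwards [hev x] with u hu
    exact (hfP u hu.1 hu.2.1 hu.2.2).symm
  have hper : ∀ z, ∀ l ∈ L.lattice, f (z + l) = f z := by
    intro z l hl
    have e1 : z + l - w ∈ L.lattice ↔ z - w ∈ L.lattice := by
      rw [show z + l - w = z - w + l by ring]; exact add_mem_lattice_iff hl
    have e2 : z + l + w ∈ L.lattice ↔ z + w ∈ L.lattice := by
      rw [show z + l + w = z + w + l by ring]; exact add_mem_lattice_iff hl
    simp only [hf, add_mem_lattice_iff hl, e1, e2]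
    split_ifs with a b
    · rfl
    · rfl
    · push Not at b
      simp only [hPdef, L.zetaKernel_add hl b.1 b.2, L.weierstrassP_add_coe z ⟨l, hl⟩]
  -- Evenness carries continuity from `w` to `-w`; translation then covers all exceptional points.
  have heven : ∀ z, f (-z) = f z := by
    intro z
    have e1 : -z - w ∈ L.lattice ↔ z + w ∈ L.lattice := by
      rw [show -z - w = -(z + w) by ring, neg_mem_iff]
    have e2 : -z + w ∈ L.lattice ↔ z - w ∈ L.lattice := by
      rw [show -z + w = -(z - w) by ring, neg_mem_iff]
    simp only [hf, neg_mem_iff, e1, e2, or_comm (a := z + w ∈ L.lattice), hPdef, weierstrassP_neg,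
      zetaKernel_neg]
  have hshift : ∀ x l : ℂ, l ∈ L.lattice → ContinuousAt f x → ContinuousAt f (x + l) := by
    intro x l hl hx
    have h : ContinuousAt (fun z ↦ f (z - l)) (x + l) :=
      ContinuousAt.comp (g := f) (f := fun z ↦ z - l) (by simpa using hx) (by fun_prop)
    have e : (fun z ↦ f (z - l)) = f := by
      ext z
      rw [← hper (z - l) l hl, sub_add_cancel]
    rwa [e] at h
  have hc0 : ContinuousAt f 0 := hlim 0 (by simpa [hf] using hc)
  have hfw : f w = L.derivWeierstrassP w := by simp [hf, hw]
  have hcw : ContinuousAt f w := hlim w (by rw [hfw]; exact L.tendsto_mul_zetaKernel_self hw hw2)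
  have hcw' : ContinuousAt f (-w) := by
    have h : ContinuousAt (fun z ↦ f (-z)) (-w) :=
      ContinuousAt.comp (g := f) (f := fun z ↦ -z) (by simpa using hcw) (by fun_prop)
    simpa [heven] using h
  have hcont : Continuous f := by
    rw [continuous_iff_continuousAt]
    intro x
    by_cases a : x ∈ L.lattice
    · simpa using hshift 0 x a hc0
    by_cases b : x - w ∈ L.lattice
    · simpa using hshift w _ b hcw
    by_cases d : x + w ∈ L.lattice
    · simpa using hshift (-w) _ d hcw'
    exact (hdiff x a b d).continuousAt
  have h := L.eq_of_periodic_of_continuous hcont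
    (fun x ↦ (hev x).mono fun u hu ↦ hdiff u hu.1 hu.2.1 hu.2.2) hper u w
  rw [hfw, hfP u hu h1 h2] at h
  exact h

end Kernel

/-! ### Addition formulas for `℘`, obtained by differentiating the kernel. -/

section Addition

theorem two_mul_notMem_lattice {w : ℂ} (hw' : L.derivWeierstrassP w ≠ 0) :
    2 * w ∉ L.lattice := by
  intro h
  have e := L.derivWeierstrassP_sub_coe w ⟨2 * w, h⟩
  rw [show w - (⟨2 * w, h⟩ : L.lattice).1 = -w by simp; ring, derivWeierstrassP_neg] at e
  exact hw' (self_eq_neg.mp e.symm)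

theorem sub_notMem_lattice {w u : ℂ} (h : L.weierstrassP u ≠ L.weierstrassP w) :
    u - w ∉ L.lattice := by
  intro hm
  apply h
  have := L.weierstrassP_add_coe w ⟨u - w, hm⟩
  rwa [add_sub_cancel] at this

theorem add_notMem_lattice {w u : ℂ} (h : L.weierstrassP u ≠ L.weierstrassP w) :
    u + w ∉ L.lattice := by
  have := L.sub_notMem_lattice (w := -w) (u := u) (by simpa using h)
  rwa [sub_neg_eq_add] at this

theorem zetaKernel_eq {w u : ℂ} (hw : w ∉ L.lattice) (hw' : L.derivWeierstrassP w ≠ 0)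
    (hu : u ∉ L.lattice) (h : L.weierstrassP u ≠ L.weierstrassP w) :
    L.zetaKernel w u = L.derivWeierstrassP w / (L.weierstrassP u - L.weierstrassP w) := by
  rw [eq_div_iff (sub_ne_zero.mpr h), mul_comm]
  exact L.sub_mul_zetaKernel hw (L.two_mul_notMem_lattice hw') hu (L.sub_notMem_lattice h)
    (L.add_notMem_lattice h)

/-- Differentiating `℘'² = 4℘³ - g₂℘ - g₃` gives `2℘'℘''`; the factor `2℘'(w)` is then cancelled. -/
theorem hasDerivAt_derivWeierstrassP {w : ℂ} (hw : w ∉ L.lattice)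
    (hw' : L.derivWeierstrassP w ≠ 0) :
    HasDerivAt L.derivWeierstrassP (6 * L.weierstrassP w ^ 2 - L.g₂ / 2) w := by
  have h1 : HasDerivAt L.derivWeierstrassP (deriv L.derivWeierstrassP w) w :=
    (L.differentiableOn_derivWeierstrassP.differentiableAt
      (L.isOpen_compl_lattice.mem_nhds hw)).hasDerivAt
  have hP := L.hasDerivAt_weierstrassP hw
  have h2 := h1.fun_pow 2
  have h3 := (((hP.fun_pow 3).const_mul 4).fun_sub (hP.const_mul L.g₂)).sub_const L.g₃
  have h4 := h2.unique (h3.congr_of_eventuallyEq (by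
    filter_upwards [L.isOpen_compl_lattice.mem_nhds hw] with u hu
    exact L.derivWeierstrassP_sq u hu))
  refine h1.congr_deriv ?_
  refine mul_left_cancel₀ (mul_ne_zero two_ne_zero hw') ?_
  simp only [Nat.cast_ofNat, Nat.add_one_sub_one, pow_one] at h4
  linear_combination h4

/-- This is the `u`-derivative of `K = ℘'(w)/(℘(u) - ℘(w))`. -/
theorem weierstrassP_add_sub {w u : ℂ} (hw : w ∉ L.lattice) (hw' : L.derivWeierstrassP w ≠ 0)
    (hu : u ∉ L.lattice) (h : L.weierstrassP u ≠ L.weierstrassP w) :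
    L.weierstrassP (u + w) - L.weierstrassP (u - w)
      = -(L.derivWeierstrassP w * L.derivWeierstrassP u)
        / (L.weierstrassP u - L.weierstrassP w) ^ 2 := by
  have hP := L.hasDerivAt_weierstrassP hu
  have h1 := L.hasDerivAt_zetaKernel (L.sub_notMem_lattice h) (L.add_notMem_lattice h)
  have h2 := (hasDerivAt_const u (L.derivWeierstrassP w)).fun_div (hP.sub_const (L.weierstrassP w))
    (sub_ne_zero.mpr h)
  have h3 := h1.unique (h2.congr_of_eventuallyEq (by
    filter_upwards [L.isOpen_compl_lattice.mem_nhds hu, hP.continuousAt.eventually_ne h]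
      with v hv hv'
    exact L.zetaKernel_eq hw hw' hv hv'))
  rw [h3]
  ring

/-- This is the `w`-derivative of the same identity; the numerator contributes `℘''(w)`. -/
theorem weierstrassP_add_add {w u : ℂ} (hw : w ∉ L.lattice) (hw' : L.derivWeierstrassP w ≠ 0)
    (hu : u ∉ L.lattice) (h : L.weierstrassP u ≠ L.weierstrassP w) :
    L.weierstrassP (u - w) + L.weierstrassP (u + w) = 2 * L.weierstrassP w
      + (6 * L.weierstrassP w ^ 2 - L.g₂ / 2) / (L.weierstrassP u - L.weierstrassP w)
      + L.derivWeierstrassP w ^ 2 / (L.weierstrassP u - L.weierstrassP w) ^ 2 := by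
  have hP := L.hasDerivAt_weierstrassP hw
  have hP' := L.hasDerivAt_derivWeierstrassP hw hw'
  have hne := sub_ne_zero.mpr h
  have h1 := L.hasDerivAt_zetaKernel_left hw (L.sub_notMem_lattice h) (L.add_notMem_lattice h)
  have h2 := hP'.fun_div (hP.const_sub (L.weierstrassP u)) hne
  have h3 := h1.unique (h2.congr_of_eventuallyEq (by
    filter_upwards [L.isOpen_compl_lattice.mem_nhds hw, hP.continuousAt.eventually_ne h.symm,
      hP'.continuousAt.eventually_ne hw'] with v hv hv' hv''
    exact L.zetaKernel_eq hv hv'' hu hv'.symm))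
  rw [sub_eq_iff_eq_add'] at h3
  rw [h3]
  field_simp
  ring

theorem weierstrassP_add_add_of_mem {w u : ℂ} (hu : u ∈ L.lattice) :
    L.weierstrassP (u - w) + L.weierstrassP (u + w) = 2 * L.weierstrassP w := by
  have h1 := L.weierstrassP_add_coe (-w) ⟨u, hu⟩
  have h2 := L.weierstrassP_add_coe w ⟨u, hu⟩
  rw [show u - w = -w + u by ring, add_comm u w]
  simp only [weierstrassP_neg] at h1 h2
  rw [h1, h2]
  ring

end Addition

end PeriodPair

/-! ### Calculus along a piecewise smooth path. -/

/-- Where `u' ≠ 0` the path leaves `u t` at once and avoids `Z` for a while, so the parameters are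
isolated from the right, and there are only countably many such. -/
theorem countable_setOf_mem_of_isolated {u : ℝ → ℂ} {Z : Set ℂ}
    (hZ : ∀ z, ∀ᶠ v in 𝓝[≠] z, v ∉ Z) : {t | u t ∈ Z ∧ deriv u t ≠ 0}.Countable := by
  refine (countable_setOfPred_isolated_right_within
    (s := {t | u t ∈ Z ∧ deriv u t ≠ 0})).mono ?_
  intro t ht
  refine ⟨ht, ?_⟩
  have hd : HasDerivAt u (deriv u t) t :=
    (differentiableAt_of_deriv_ne_zero ht.2).hasDerivAt
  have h := (hd.tendsto_nhdsNE ht.2).eventually (hZ (u t))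
  rw [← empty_mem_iff_bot]
  have h' : ∀ᶠ s in 𝓝[{t | u t ∈ Z ∧ deriv u t ≠ 0} ∩ Set.Ioi t] t, u s ∉ Z :=
    h.filter_mono (nhdsWithin_mono _ fun s hs ↦ ne_of_gt hs.2)
  filter_upwards [h', self_mem_nhdsWithin] with s hs hs'
  exact hs hs'.1.1

theorem intervalIntegrable_comp_mul_deriv {u f : ℝ → ℂ} {a b : ℝ} (hab : a ≤ b)
    (hi : IntervalIntegrable (deriv u) MeasureTheory.volume a b)
    (hf : ContinuousOn f (Set.Icc a b)) :
    IntervalIntegrable (fun t ↦ f t * deriv u t) MeasureTheory.volume a b :=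
  hi.continuousOn_mul (by rwa [Set.uIcc_of_le hab])

theorem integral_comp_mul_deriv_off_countable {u F f : ℝ → ℂ} {a b : ℝ} (hab : a ≤ b)
    (hi : IntervalIntegrable (deriv u) MeasureTheory.volume a b) {S : Set ℝ} (hS : S.Countable)
    (hF : ContinuousOn F (Set.Icc a b)) (hf : ContinuousOn f (Set.Icc a b))
    (hd : ∀ t ∈ Set.Ioo a b \ S, HasDerivAt F (f t * deriv u t) t) :
    ∫ t in a..b, f t * deriv u t = F b - F a :=
  MeasureTheory.integral_eq_of_hasDerivAt_off_countable_of_le _ _ hab hS hF hd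
    (intervalIntegrable_comp_mul_deriv hab hi hf)

/-- After extension by constants beyond `[a, b]`, the path lifts through `exp` because `ℝ` is simply
connected. -/
theorem exists_continuousOn_exp_eq {a b : ℝ} (hab : a ≤ b) {g : ℝ → ℂ}
    (hg : ContinuousOn g (Set.Icc a b)) (h0 : ∀ t ∈ Set.Icc a b, g t ≠ 0) :
    ∃ ℓ : ℝ → ℂ, ContinuousOn ℓ (Set.Icc a b) ∧ ∀ t ∈ Set.Icc a b, Complex.exp (ℓ t) = g t := by
  have hu : IsSimplyConnected (Set.univ : Set ℝ) := by
    have := (convex_univ (𝕜 := ℝ) (E := ℝ)).contractibleSpace Set.univ_nonempty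
    exact SimplyConnectedSpace.ofContractible _
  obtain ⟨ℓ, hc, he⟩ := Complex.exists_continuousOn_eqOn_exp_comp hu isOpen_univ
    (g := Set.IccExtend hab (Set.domRestrict (Set.Icc a b) g))
    (continuousOn_iff_continuous_domRestrict.mp hg).Icc_extend'.continuousOn (by
      rintro ⟨t, -, ht⟩
      exact h0 _ (Set.projIcc a b hab t).2 ht)
  refine ⟨ℓ, hc.mono (Set.subset_univ _), fun t ht ↦ ?_⟩
  have := he (Set.mem_univ t)
  rw [Set.IccExtend_of_mem hab _ ht] at this
  exact this

/-- Near `t` continuity gives `|ℓ s - ℓ t| < 1 < π`, so `ℓ s - ℓ t` is the principal logarithm of `g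
s / g t`. -/
theorem hasDerivAt_of_exp_eventuallyEq {ℓ g : ℝ → ℂ} {t : ℝ} {g' : ℂ} (hc : ContinuousAt ℓ t)
    (he : ∀ᶠ s in 𝓝 t, Complex.exp (ℓ s) = g s) (hg : HasDerivAt g (g' * g t) t) :
    HasDerivAt ℓ g' t := by
  have he0 := he.self_of_nhds
  have hloc : ∀ᶠ s in 𝓝 t, ℓ s = ℓ t + Complex.log (g s / g t) := by
    have hball : ∀ᶠ s in 𝓝 t, ‖ℓ s - ℓ t‖ < 1 := by
      have := hc.eventually (Metric.ball_mem_nhds (ℓ t) one_pos)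
      filter_upwards [this] with s hs
      simpa [dist_eq_norm] using hs
    filter_upwards [he, hball] with s hs hb
    rw [← hs, ← he0, ← Complex.exp_sub, Complex.log_exp]
    · ring
    · have := (abs_lt.mp ((Complex.abs_im_le_norm _).trans_lt hb)).1
      linarith [Real.pi_gt_three]
    · have := (abs_lt.mp ((Complex.abs_im_le_norm _).trans_lt hb)).2
      linarith [Real.pi_gt_three]
  have hne : g t ≠ 0 := he0 ▸ Complex.exp_ne_zero _
  have h1 : HasDerivAt (fun s ↦ g s / g t) g' t :=
    (hg.div_const (g t)).congr_deriv (by field_simp)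
  have h2 : HasDerivAt (fun s ↦ Complex.log (g s / g t)) (g' / (g t / g t)) t :=
    h1.clog_real (by simp [div_self hne])
  rw [div_self hne, div_one] at h2
  exact (h2.const_add (ℓ t)).congr_of_eventuallyEq hloc

/-! ### Zeros of `℘'`, half-periods, and the exact period integral. -/

namespace PeriodPair

variable (L : PeriodPair)

theorem eventually_notMem_and_derivWeierstrassP_ne_zero {w : ℂ} (hw : w ∉ L.lattice)
    (hw' : L.derivWeierstrassP w ≠ 0) (z : ℂ) :
    ∀ᶠ v in 𝓝[≠] z, v ∉ {v | v ∈ L.lattice ∨ L.derivWeierstrassP v = 0} := by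
  have h : ∀ᶠ v in 𝓝[≠] z, L.derivWeierstrassP v ≠ 0 := by
    by_cases hz : z ∈ L.lattice
    -- At a lattice point `(v - z)³ ℘'(v)` tends to `-2`, so `℘'` cannot vanish nearby.
    · have hc : ContinuousAt (fun v ↦ (v - z) ^ 3 * L.derivWeierstrassPExcept z v - 2) z :=
        (((continuousAt_id.sub continuousAt_const).pow 3).mul
          (L.analyticAt_derivWeierstrassPExcept z).continuousAt).sub continuousAt_const
      filter_upwards [mem_nhdsWithin_of_mem_nhds (hc.eventually_ne (y := 0) (by simp)),
        self_mem_nhdsWithin] with v hv hvz h0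
      have hvz : v - z ≠ 0 := sub_ne_zero.mpr hvz
      have e := L.derivWeierstrassPExcept_sub ⟨z, hz⟩ v
      rw [h0, sub_eq_zero] at e
      apply hv
      simp only at e
      rw [e]
      field_simp
      ring
    · refine (L.analyticOnNhd_derivWeierstrassP z hz).eventually_eq_zero_or_eventually_ne_zero
        |>.resolve_left fun h0 ↦ hw' ?_
      exact L.analyticOnNhd_derivWeierstrassP.eqOn_zero_of_preconnected_of_eventuallyEq_zero
        L.isPreconnected_compl_lattice hz h0 hw
  filter_upwards [h, L.eventually_add_notMem_lattice 0 z] with v h1 h2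
  rw [add_zero] at h2
  simp [h1, h2]

theorem halfPeriod_notMem_lattice (i : Fin 3) : L.halfPeriod i ∉ L.lattice := by
  have h := L.mul_ω₁_add_mul_ω₂_mem_lattice (α := -1 / 2) (β := -1 / 2)
  fin_cases i
  · exact L.ω₁_div_two_notMem_lattice
  · have e : ((-1 / 2 : ℚ) : ℂ) * L.ω₁ + ((-1 / 2 : ℚ) : ℂ) * L.ω₂ = L.halfPeriod 1 := by
      simp [halfPeriod]
      ring
    rw [e] at h
    exact fun hm ↦ absurd (h.mp hm).1 (by norm_num)
  · exact L.ω₂_div_two_notMem_lattice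

theorem two_mul_halfPeriod_mem_lattice (i : Fin 3) : 2 * L.halfPeriod i ∈ L.lattice := by
  rw [mem_lattice]
  fin_cases i
  · exact ⟨1, 0, by simp [halfPeriod]; ring⟩
  · exact ⟨-1, -1, by simp [halfPeriod]; ring⟩
  · exact ⟨0, 1, by simp [halfPeriod]; ring⟩

/-- Twice the contour base and twice `ωᵢ` again form a basis of the lattice, so lattice points have
even coordinates. -/
theorem exists_int_of_mul_contourBase_mem {i : Fin 3} {r s : ℝ}
    (h : r * L.contourBase i + s * L.halfPeriod i ∈ L.lattice) : ∃ n : ℤ, r = 2 * n := by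
  obtain ⟨m, n, e⟩ := mem_lattice.mp h
  have hind : ∀ p q : ℝ, (p : ℂ) * L.ω₁ + q * L.ω₂ = 0 → p = 0 ∧ q = 0 := by
    intro p q hpq
    exact LinearIndependent.pair_iff.mp L.indep p q (by simpa using hpq)
  fin_cases i <;> simp [contourBase, halfPeriod] at e
  · have := hind (m - (s - r) / 2) (n + r / 2) (by push_cast; linear_combination e)
    exact ⟨-n, by push_cast; linarith [this.2]⟩
  · have := hind (m + s / 2) (n - (r - s) / 2) (by push_cast; linear_combination e)
    exact ⟨n - m, by push_cast; linarith [this.1, this.2]⟩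
  · have := hind (m + r / 2) (n - (s - r) / 2) (by push_cast; linear_combination e)
    exact ⟨-m, by push_cast; linarith [this.1]⟩

theorem contourBase_strip_notMem_lattice {i : Fin 3} {r s : ℝ} (h0 : 0 < r) (h2 : r < 2) :
    r * L.contourBase i + s * L.halfPeriod i ∉ L.lattice := by
  intro h
  obtain ⟨n, rfl⟩ := L.exists_int_of_mul_contourBase_mem h
  have h1 : (0 : ℝ) < n := by linarith
  have h3 : (n : ℝ) < 1 := by linarith
  norm_cast at h1 h3
  omega

/-- Fubini for `℘(c + 2tω + τw)`: the `τ`-integral produces the zeta difference, while the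
`t`-integral is a quasi-period, independent of `τ`. No logarithm occurs, so no multiple of `2πi` is
left open. -/
theorem integral_weierstrassZeta_sub {c w ω : ℂ} (hω : ω ∉ L.lattice) (hω2 : 2 * ω ∈ L.lattice)
    (h : ∀ t ∈ Set.Icc (0 : ℝ) 1, ∀ τ ∈ Set.Icc (-1 : ℝ) 1, c + 2 * t * ω + τ * w ∉ L.lattice) :
    ∫ t in (0 : ℝ)..1, (L.weierstrassZeta (c + 2 * t * ω - w)
      - L.weierstrassZeta (c + 2 * t * ω + w)) * (2 * ω) = -4 * L.weierstrassZeta ω * w := by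
  set F : ℝ → ℝ → ℂ := fun t τ ↦ L.weierstrassP (c + 2 * t * ω + τ * w) * w * (2 * ω) with hF
  have hcont : ContinuousOn (Function.uncurry F) (Set.Icc 0 1 ×ˢ Set.Icc (-1) 1) := by
    have : ContinuousOn (fun p : ℝ × ℝ ↦ L.weierstrassP (c + 2 * p.1 * ω + p.2 * w))
        (Set.Icc 0 1 ×ˢ Set.Icc (-1) 1) :=
      L.differentiableOn_weierstrassP.continuousOn.comp (by fun_prop)
        fun p hp ↦ h p.1 hp.1 p.2 hp.2
    exact (this.mul continuousOn_const).mul continuousOn_const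
  have h1 : ∀ t ∈ Set.Icc (0 : ℝ) 1, ∫ τ in (-1 : ℝ)..1, F t τ =
      (L.weierstrassZeta (c + 2 * t * ω - w) - L.weierstrassZeta (c + 2 * t * ω + w))
        * (2 * ω) := by
    intro t ht
    have hd : ∀ τ ∈ Set.uIcc (-1 : ℝ) 1, HasDerivAt
        (fun τ : ℝ ↦ -L.weierstrassZeta (c + 2 * t * ω + τ * w) * (2 * ω)) (F t τ) τ := by
      intro τ hτ
      rw [Set.uIcc_of_le (by norm_num)] at hτ
      have e : HasDerivAt (fun τ : ℝ ↦ c + 2 * t * ω + τ * w) w τ := by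
        simpa using ((Complex.ofRealCLM.hasDerivAt (x := τ)).mul_const w).const_add (c + 2 * t * ω)
      exact (((L.hasDerivAt_weierstrassZeta (h t ht τ hτ)).comp τ e).neg.mul_const
        (2 * ω)).congr_deriv (by simp [hF])
    rw [intervalIntegral.integral_eq_sub_of_hasDerivAt hd]
    · push_cast
      rw [show c + 2 * t * ω + 1 * w = c + 2 * t * ω + w by ring,
        show c + 2 * t * ω + -1 * w = c + 2 * t * ω - w by ring]
      ring
    · refine ContinuousOn.intervalIntegrable ?_
      rw [Set.uIcc_of_le (by norm_num)]
      exact hcont.comp (f := fun τ ↦ (t, τ)) (by fun_prop) fun τ hτ ↦ ⟨ht, hτ⟩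
  have h2 : ∀ τ ∈ Set.Icc (-1 : ℝ) 1, ∫ t in (0 : ℝ)..1, F t τ = -2 * L.weierstrassZeta ω * w := by
    intro τ hτ
    have hd : ∀ t ∈ Set.uIcc (0 : ℝ) 1, HasDerivAt
        (fun t : ℝ ↦ -L.weierstrassZeta (c + 2 * t * ω + τ * w) * w) (F t τ) t := by
      intro t ht
      rw [Set.uIcc_of_le (by norm_num)] at ht
      have e : HasDerivAt (fun t : ℝ ↦ c + 2 * t * ω + τ * w) (2 * ω) t := by
        simpa using ((((Complex.ofRealCLM.hasDerivAt (x := t)).const_mul 2).mul_const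
          ω).const_add c).add_const (τ * w)
      refine (((L.hasDerivAt_weierstrassZeta (h t ht τ hτ)).comp t e).neg.mul_const
        w).congr_deriv ?_
      simp only [hF]
      ring
    rw [intervalIntegral.integral_eq_sub_of_hasDerivAt hd]
    · have h0 := h 0 (by simp) τ hτ
      have e := L.weierstrassZeta_add_two_mul hω hω2 h0
      push_cast at e ⊢
      rw [show c + 2 * 1 * ω + τ * w = c + 2 * 0 * ω + τ * w + 2 * ω by ring, e]
      ring
    · refine ContinuousOn.intervalIntegrable ?_
      rw [Set.uIcc_of_le (by norm_num)]
      exact hcont.comp (f := fun t ↦ (t, τ)) (by fun_prop) fun t ht ↦ ⟨ht, hτ⟩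
  have hswap : ∫ t in (0 : ℝ)..1, ∫ τ in (-1 : ℝ)..1, F t τ
      = ∫ τ in (-1 : ℝ)..1, ∫ t in (0 : ℝ)..1, F t τ := by
    refine MeasureTheory.intervalIntegral_intervalIntegral_swap ?_
    have hi := hcont.integrableOn_compact (μ := MeasureTheory.volume)
      (isCompact_Icc.prod isCompact_Icc)
    refine hi.mono_set (Set.prod_mono ?_ ?_)
    · rw [Set.uIoc_of_le (by norm_num)]; exact Set.Ioc_subset_Icc_self
    · rw [Set.uIoc_of_le (by norm_num)]; exact Set.Ioc_subset_Icc_self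
  rw [← intervalIntegral.integral_congr (f := fun t ↦ ∫ τ in (-1 : ℝ)..1, F t τ) (fun t ht ↦ by
    rw [Set.uIcc_of_le (by norm_num)] at ht
    exact h1 t ht), hswap,
    intervalIntegral.integral_congr (g := fun _ ↦ -2 * L.weierstrassZeta ω * w) (fun τ hτ ↦ by
    rw [Set.uIcc_of_le (by norm_num)] at hτ
    exact h2 τ hτ), intervalIntegral.integral_const]
  simp
  ring

end PeriodPair

/-! ### The quartic, its roots and the Möbius map to the cubic. -/

namespace O4

/-- The five samples `±1, ±2, 3` determine the coefficients; `0` is avoided because the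
factorisation holds only for `ζ ≠ 0`. -/
theorem quartic_coeff_eq_zero {d₀ d₁ d₂ d₃ d₄ : ℂ}
    (h : ∀ ζ : ℂ, ζ ≠ 0 → d₀ + d₁ * ζ + d₂ * ζ ^ 2 + d₃ * ζ ^ 3 + d₄ * ζ ^ 4 = 0) :
    d₀ = 0 ∧ d₁ = 0 ∧ d₂ = 0 ∧ d₃ = 0 ∧ d₄ = 0 := by
  have h1 := h 1 (by norm_num)
  have h2 := h (-1) (by norm_num)
  have h3 := h 2 (by norm_num)
  have h4 := h (-2) (by norm_num)
  have h5 := h 3 (by norm_num)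
  have e1 : d₁ = 0 := by linear_combination (2/3) * h1 - (2/3) * h2 - h3 / 12 + h4 / 12
  have e3 : d₃ = 0 := by linear_combination -h1 / 6 + h2 / 6 + h3 / 12 - h4 / 12
  subst e1 e3
  have e4 : d₄ = 0 := by linear_combination h1 / 24 - h3 / 15 + h5 / 40
  subst e4
  have e2 : d₂ = 0 := by linear_combination -h1 / 3 + h3 / 3
  subst e2
  exact ⟨by linear_combination h1, rfl, rfl, rfl, rfl⟩

variable {x ρ : ℝ} {v z α β s : ℂ}

theorem one_add_mul_conj_ne_zero (α : ℂ) : 1 + α * conj α ≠ 0 := by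
  rw [Complex.mul_conj']
  have : (0 : ℝ) < 1 + ‖α‖ ^ 2 := by positivity
  exact_mod_cast this.ne'

theorem coeff_eq (hη : ∀ ζ : ℂ, ζ ≠ 0 → eta4 x v z ζ =
      ρ / ζ ^ 2 * ((ζ - α) * (conj α * ζ + 1) / (1 + (‖α‖ : ℂ) ^ 2))
        * ((ζ - β) * (conj β * ζ + 1) / (1 + (‖β‖ : ℂ) ^ 2))) :
    conj z * ((1 + α * conj α) * (1 + β * conj β)) = ρ * (α * β) ∧
    conj v * ((1 + α * conj α) * (1 + β * conj β))
      = -ρ * (α * (1 - β * conj β) + β * (1 - α * conj α)) ∧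
    x * ((1 + α * conj α) * (1 + β * conj β))
      = ρ * ((1 - α * conj α) * (1 - β * conj β) - conj α * β - α * conj β) ∧
    v * ((1 + α * conj α) * (1 + β * conj β))
      = -ρ * (conj α * (1 - β * conj β) + conj β * (1 - α * conj α)) ∧
    z * ((1 + α * conj α) * (1 + β * conj β)) = ρ * (conj α * conj β) := by
  have hα := one_add_mul_conj_ne_zero α
  have hβ := one_add_mul_conj_ne_zero β
  set N := (1 + α * conj α) * (1 + β * conj β) with hN
  have h := quartic_coeff_eq_zero
    (d₀ := conj z * N - ρ * (α * β))
    (d₁ := conj v * N + ρ * (α * (1 - β * conj β) + β * (1 - α * conj α)))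
    (d₂ := x * N - ρ * ((1 - α * conj α) * (1 - β * conj β) - conj α * β - α * conj β))
    (d₃ := -(v * N) - ρ * (conj α * (1 - β * conj β) + conj β * (1 - α * conj α)))
    (d₄ := z * N - ρ * (conj α * conj β)) (by
      intro ζ hζ
      have e := hη ζ hζ
      rw [← Complex.mul_conj', ← Complex.mul_conj'] at e
      have e' : quartic x v z ζ * N = ρ * ((ζ - α) * (conj α * ζ + 1))
          * ((ζ - β) * (conj β * ζ + 1)) := by
        rw [quartic_eq x v z ζ hζ, e, hN]
        field_simp
      unfold quartic at e'
      linear_combination e')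
  obtain ⟨h0, h1, h2, h3, h4⟩ := h
  exact ⟨by linear_combination h0, by linear_combination h1, by linear_combination h2,
    by linear_combination -h3, by linear_combination h4⟩

theorem ne_zero_of_coeff (hz : z ≠ 0)
    (h : z * ((1 + α * conj α) * (1 + β * conj β)) = ρ * (conj α * conj β)) :
    α ≠ 0 ∧ β ≠ 0 := by
  have hN := mul_ne_zero hz (mul_ne_zero (one_add_mul_conj_ne_zero α) (one_add_mul_conj_ne_zero β))
  rw [h] at hN
  constructor <;> rintro rfl <;> simp at hN

theorem kSq_eq (α β : ℂ) : (kSq α β : ℂ)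
    = (1 + conj α * β) * (1 + α * conj β) / ((1 + α * conj α) * (1 + β * conj β)) := by
  unfold kSq
  push_cast
  rw [← Complex.mul_conj', ← Complex.mul_conj', ← Complex.mul_conj']
  simp

theorem e1_sub_e3 (ρ : ℝ) (α β : ℂ) : (e1 ρ α β : ℂ) - e3 ρ α β = ρ := by
  unfold e1 e3
  push_cast
  ring

theorem XInf_eq (hα : α ≠ 0) :
    XInf ρ α β = e3 ρ α β + ρ * (1 + conj α * β) / (1 + α * conj α) := by
  have h : conj α ≠ 0 := by simpa using hα
  have h1 := one_add_mul_conj_ne_zero α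
  have h2 : -1 / conj α - α ≠ 0 := by
    intro e
    apply h1
    field_simp at e
    linear_combination -e
  unfold XInf
  rw [e1_sub_e3, mul_div_assoc]
  congr 2
  rw [div_eq_div_iff h2 h1]
  field_simp
  ring

theorem XMap_eq (hα : α ≠ 0) (ζ : ℂ) : XMap ρ α β ζ
    = e3 ρ α β + ρ * (1 + conj α * β) * (ζ - α) / ((1 + α * conj α) * (ζ - β)) := by
  have h := XInf_eq (ρ := ρ) (β := β) hα
  unfold XInf at h
  have h' := add_left_cancel h
  unfold XMap crossRatio
  have : ((ζ - α) * (-1 / conj α - β)) / ((ζ - β) * (-1 / conj α - α))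
      = (-1 / conj α - β) / (-1 / conj α - α) * ((ζ - α) / (ζ - β)) := by
    rw [div_mul_div_comm]; ring
  rw [this, ← mul_assoc, h', div_mul_div_comm]

theorem XInf_sub_XMap_zero (hα : α ≠ 0) (hβ : β ≠ 0) : XInf ρ α β - XMap ρ α β 0
    = ρ * (1 + conj α * β) * (β - α) / ((1 + α * conj α) * β) := by
  have h1 := one_add_mul_conj_ne_zero α
  rw [XInf_eq hα, XMap_eq hα]
  simp only [zero_sub, mul_neg, neg_div_neg_eq]
  field_simp
  ring

/-- A Möbius map is fixed by its pole `β` and its values at `∞` and `0`. -/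
theorem XMap_eq_add (hα : α ≠ 0) (hβ : β ≠ 0) {ζ : ℂ} (hζ : ζ ≠ β) : XMap ρ α β ζ
    = XInf ρ α β + β * (XInf ρ α β - XMap ρ α β 0) / (ζ - β) := by
  have h1 := one_add_mul_conj_ne_zero α
  have h2 := sub_ne_zero.mpr hζ
  rw [XInf_sub_XMap_zero hα hβ, XInf_eq hα, XMap_eq hα]
  field_simp
  ring

theorem hasDerivAt_XMap (hα : α ≠ 0) (hβ : β ≠ 0) {ζ : ℂ} (hζ : ζ ≠ β) :
    HasDerivAt (XMap ρ α β) (-(β * (XInf ρ α β - XMap ρ α β 0)) / (ζ - β) ^ 2) ζ := by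
  have h2 := sub_ne_zero.mpr hζ
  have h := ((hasDerivAt_const ζ (β * (XInf ρ α β - XMap ρ α β 0))).fun_div
    ((hasDerivAt_id ζ).sub_const β) h2).const_add (XInf ρ α β)
  refine (h.congr_of_eventuallyEq ?_).congr_deriv (by simp)
  filter_upwards [isOpen_ne.mem_nhds hζ] with ξ hξ
  exact XMap_eq_add hα hβ hξ

/-- This is the formula for `℘(u - w) + ℘(u + w)` at `ζ = β`, where `u ∈ Λ` and both terms equal
`℘(w) = X_∞`. -/
theorem four_mul_sq_sub (hα : α ≠ 0)
    (hv : v * ((1 + α * conj α) * (1 + β * conj β))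
      = -ρ * (conj α * (1 - β * conj β) + conj β * (1 - α * conj α)))
    (hx : x * ((1 + α * conj α) * (1 + β * conj β))
      = ρ * ((1 - α * conj α) * (1 - β * conj β) - conj α * β - α * conj β))
    (hz : z * ((1 + α * conj α) * (1 + β * conj β)) = ρ * (conj α * conj β)) :
    4 * z * β ^ 2 - 2 * v * β = 2 * XInf ρ α β - 2 * x / 3 := by
  have h1 := one_add_mul_conj_ne_zero α
  have h2 := one_add_mul_conj_ne_zero β
  rw [XInf_eq hα]
  unfold e3
  push_cast
  rw [kSq_eq, eq_div_of_mul_eq (mul_ne_zero h1 h2) hv, eq_div_of_mul_eq (mul_ne_zero h1 h2) hx,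
    eq_div_of_mul_eq (mul_ne_zero h1 h2) hz]
  -- The identity is rational with conjugates treated as independent variables.
  generalize conj α = a' at *
  generalize conj β = b' at *
  have h1' : 1 + a' * α ≠ 0 := by rwa [mul_comm]
  have h2' : 1 + b' * β ≠ 0 := by rwa [mul_comm]
  field_simp
  ring

/-- The right side is `℘''(w)`; the identity matches the coefficient of `ζ - β` in `℘(u - w) + ℘(u +
w)`. -/
theorem eight_mul_sq_sub (hα : α ≠ 0) (hβ : β ≠ 0)
    (hz' : conj z * ((1 + α * conj α) * (1 + β * conj β)) = ρ * (α * β))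
    (hv' : conj v * ((1 + α * conj α) * (1 + β * conj β))
      = -ρ * (α * (1 - β * conj β) + β * (1 - α * conj α)))
    (hv : v * ((1 + α * conj α) * (1 + β * conj β))
      = -ρ * (conj α * (1 - β * conj β) + conj β * (1 - α * conj α)))
    (hx : x * ((1 + α * conj α) * (1 + β * conj β))
      = ρ * ((1 - α * conj α) * (1 - β * conj β) - conj α * β - α * conj β))
    (hz : z * ((1 + α * conj α) * (1 + β * conj β)) = ρ * (conj α * conj β)) :
    (8 * z * β ^ 2 - 2 * v * β) * (XInf ρ α β - XMap ρ α β 0)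
      = 6 * XInf ρ α β ^ 2 - 2 * g2 x v z := by
  have h1 := one_add_mul_conj_ne_zero α
  have h2 := one_add_mul_conj_ne_zero β
  have hN := mul_ne_zero h1 h2
  rw [XInf_sub_XMap_zero hα hβ, XInf_eq hα]
  unfold e3 g2
  push_cast
  rw [← Complex.mul_conj', ← Complex.mul_conj', kSq_eq, eq_div_of_mul_eq hN hv',
    eq_div_of_mul_eq hN hz', eq_div_of_mul_eq hN hv, eq_div_of_mul_eq hN hx,
    eq_div_of_mul_eq hN hz]
  generalize conj α = a' at *
  generalize conj β = b' at *
  have h1' : 1 + a' * α ≠ 0 := by rwa [mul_comm]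
  have h2' : 1 + b' * β ≠ 0 := by rwa [mul_comm]
  field_simp
  ring

/-- The facts about the map `ζ ↦ X_ζ` and the Jacobian coordinate `w` of its pole `ζ = ∞` from
which the integrals are evaluated. -/
structure PoleData (x ρ : ℝ) (v z α β s : ℂ) (L : PeriodPair) (w : ℂ) : Prop where
  α_ne : α ≠ 0
  β_ne : β ≠ 0
  z_ne : z ≠ 0
  sq_eq : s ^ 2 = z
  sub_ne : XInf ρ α β - XMap ρ α β 0 ≠ 0
  notMem : w ∉ L.lattice
  weierstrassP_eq : L.weierstrassP w = XInf ρ α β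
  derivWeierstrassP_eq : L.derivWeierstrassP w = -2 * (β * s * (XInf ρ α β - XMap ρ α β 0))
  four_eq : 4 * z * β ^ 2 - 2 * v * β = 2 * XInf ρ α β - 2 * x / 3
  eight_eq : (8 * z * β ^ 2 - 2 * v * β) * (XInf ρ α β - XMap ρ α β 0)
    = 6 * XInf ρ α β ^ 2 - L.g₂ / 2

theorem poleData {x ρ : ℝ} {v z α β s : ℂ} (hρ : 0 < ρ) (hz : z ≠ 0) (hαβ : α ≠ β)
    (hαβ' : 1 + conj α * β ≠ 0)
    (hη : ∀ ζ : ℂ, ζ ≠ 0 → eta4 x v z ζ =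
      ρ / ζ ^ 2 * ((ζ - α) * (conj α * ζ + 1) / (1 + (‖α‖ : ℂ) ^ 2))
        * ((ζ - β) * (conj β * ζ + 1) / (1 + (‖β‖ : ℂ) ^ 2)))
    (hs : s ^ 2 = z) {L : PeriodPair} (hg2 : L.g₂ = 4 * g2 x v z) {w : ℂ}
    (hw : L.HasCoord (XInf ρ α β) (YInf ρ α β s) w) : PoleData x ρ v z α β s L w := by
  obtain ⟨hz', hv', hx, hv, hz0⟩ := coeff_eq hη
  obtain ⟨hα, hβ⟩ := ne_zero_of_coeff hz hz0
  obtain ⟨h1, h2, h3⟩ := hw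
  have hρ' : (ρ : ℂ) ≠ 0 := by exact_mod_cast hρ.ne'
  refine ⟨hα, hβ, hz, hs, ?_, h1, h2, ?_, four_mul_sq_sub hα hv hx hz0, ?_⟩
  · rw [XInf_sub_XMap_zero hα hβ]
    exact div_ne_zero (mul_ne_zero (mul_ne_zero hρ' hαβ') (sub_ne_zero.mpr hαβ.symm))
      (mul_ne_zero (one_add_mul_conj_ne_zero α) hβ)
  · rw [h3, YInf]
    ring
  · rw [eight_mul_sq_sub hα hβ hz' hv' hv hx hz0, hg2]
    ring

/-! ### Elliptic functions of the Jacobian coordinate in terms of `(ζ, η)`. -/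

namespace PoleData

variable {x ρ : ℝ} {v z α β s : ℂ} {L : PeriodPair} {w : ℂ}

theorem s_ne (d : PoleData x ρ v z α β s L w) : s ≠ 0 := by
  rintro rfl
  exact d.z_ne (by rw [← d.sq_eq]; simp)

theorem derivWeierstrassP_ne (d : PoleData x ρ v z α β s L w) : L.derivWeierstrassP w ≠ 0 := by
  rw [d.derivWeierstrassP_eq]
  exact mul_ne_zero (by norm_num) (mul_ne_zero (mul_ne_zero d.β_ne d.s_ne) d.sub_ne)

theorem weierstrassP_sub (d : PoleData x ρ v z α β s L w) {ζ Y u : ℂ} (hζ : ζ ≠ β)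
    (h : L.HasCoord (XMap ρ α β ζ) Y u) :
    L.weierstrassP u - L.weierstrassP w = β * (XInf ρ α β - XMap ρ α β 0) / (ζ - β) := by
  rw [h.2.1, d.weierstrassP_eq, XMap_eq_add d.α_ne d.β_ne hζ]
  ring

theorem weierstrassP_ne (d : PoleData x ρ v z α β s L w) {ζ Y u : ℂ} (hζ : ζ ≠ β)
    (h : L.HasCoord (XMap ρ α β ζ) Y u) : L.weierstrassP u ≠ L.weierstrassP w := by
  rw [← sub_ne_zero, d.weierstrassP_sub hζ h]
  exact div_ne_zero (mul_ne_zero d.β_ne d.sub_ne) (sub_ne_zero.mpr hζ)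

/-- Both `K` and `ζ - β` are proportional to `1/(X - X_∞)`; the normalisation of `Y_∞` makes the
ratio `-2s`. -/
theorem zetaKernel_eq (d : PoleData x ρ v z α β s L w) {ζ Y u : ℂ} (hζ : ζ ≠ β)
    (h : L.HasCoord (XMap ρ α β ζ) Y u) : L.zetaKernel w u = 2 * s * (β - ζ) := by
  have h1 := sub_ne_zero.mpr hζ
  have h2 := d.sub_ne
  have h3 := d.β_ne
  rw [L.zetaKernel_eq d.notMem d.derivWeierstrassP_ne h.1 (d.weierstrassP_ne hζ h),
    d.weierstrassP_sub hζ h, d.derivWeierstrassP_eq]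
  field_simp
  ring

theorem weierstrassP_add_add (d : PoleData x ρ v z α β s L w) {ζ Y u : ℂ} (hζ : ζ ≠ β)
    (h : L.HasCoord (XMap ρ α β ζ) Y u) :
    L.weierstrassP (u - w) + L.weierstrassP (u + w) = 4 * z * ζ ^ 2 - 2 * v * ζ + 2 * x / 3 := by
  have h1 := sub_ne_zero.mpr hζ
  have h2 := d.sub_ne
  have h3 := d.β_ne
  rw [L.weierstrassP_add_add d.notMem d.derivWeierstrassP_ne h.1 (d.weierstrassP_ne hζ h),
    d.weierstrassP_sub hζ h, d.derivWeierstrassP_eq, d.weierstrassP_eq, ← d.eight_eq]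
  have e : (8 * z * β ^ 2 - 2 * v * β) * (XInf ρ α β - XMap ρ α β 0)
        / (β * (XInf ρ α β - XMap ρ α β 0) / (ζ - β))
      + (-2 * (β * s * (XInf ρ α β - XMap ρ α β 0))) ^ 2
        / (β * (XInf ρ α β - XMap ρ α β 0) / (ζ - β)) ^ 2
      = (8 * z * β - 2 * v) * (ζ - β) + 4 * s ^ 2 * (ζ - β) ^ 2 := by
    field_simp
    ring
  rw [add_assoc, e, d.sq_eq]
  linear_combination -d.four_eq

theorem weierstrassP_add_sub (d : PoleData x ρ v z α β s L w) {ζ η u : ℂ} (hζ : ζ ≠ β)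
    (h : L.HasCoord (XMap ρ α β ζ) (YMap ρ α β ζ η) u) :
    L.weierstrassP (u + w) - L.weierstrassP (u - w) = -(4 * s * η) := by
  have h1 := sub_ne_zero.mpr hζ
  have h2 := d.sub_ne
  have h3 := d.β_ne
  rw [L.weierstrassP_add_sub d.notMem d.derivWeierstrassP_ne h.1 (d.weierstrassP_ne hζ h),
    d.weierstrassP_sub hζ h, d.derivWeierstrassP_eq, h.2.2, YMap,
    (hasDerivAt_XMap d.α_ne d.β_ne hζ).deriv]
  field_simp
  ring

/-- At `ζ = 0`, `η = -conj s`, the sum of the two values is `2x/3` and the difference is `4 s conj s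
= 4|z|`. -/
theorem weierstrassP_add_zero (d : PoleData x ρ v z α β s L w) {u₀ : ℂ}
    (h : L.HasCoord (XMap ρ α β 0) (YMap ρ α β 0 (-conj s)) u₀) :
    L.weierstrassP (w + u₀) = xPlus x z ∧ L.weierstrassP (w - u₀) = xMinus x z := by
  have h1 := d.weierstrassP_add_add d.β_ne.symm h
  have h2 := d.weierstrassP_add_sub d.β_ne.symm h
  have hn : s * conj s = (‖z‖ : ℂ) := by
    rw [Complex.mul_conj', ← d.sq_eq, norm_pow]
    push_cast
    rfl
  rw [← L.weierstrassP_neg (w - u₀), neg_sub, add_comm w]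
  unfold xPlus xMinus
  constructor
  · linear_combination h1 / 2 + h2 / 2 + 2 * hn
  · linear_combination h1 / 2 - h2 / 2 - 2 * hn

theorem weierstrassZeta_add_zero (d : PoleData x ρ v z α β s L w) {Y u₀ : ℂ}
    (h : L.HasCoord (XMap ρ α β 0) Y u₀) :
    L.weierstrassZeta (w + u₀) + L.weierstrassZeta (w - u₀)
      = 2 * L.weierstrassZeta w - 2 * s * β := by
  have e := d.zetaKernel_eq d.β_ne.symm h
  unfold PeriodPair.zetaKernel at e
  rw [← neg_sub w, L.weierstrassZeta_neg, add_comm u₀] at e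
  linear_combination -e

end PoleData

/-! ### Evaluation of the integrals along a contour. -/

section Contour

variable {x ρ : ℝ} {v z α β s : ℂ} {L : PeriodPair} {w : ℂ} {a b : ℝ} {γ y u : ℝ → ℂ}

/-- Treats `ζ = β` together with the other finite points: the lift never meets the poles `± w`, and
`ζ` is a regular function of `u` throughout. -/
theorem PoleData.lift_spec (d : PoleData x ρ v z α β s L w) {ζ Y U : ℂ}
    (h : (ζ = β ∧ U ∈ L.lattice) ∨ (ζ ≠ β ∧ L.HasCoord (XMap ρ α β ζ) Y U)) :
    U - w ∉ L.lattice ∧ U + w ∉ L.lattice ∧ ζ = β - L.zetaKernel w U / (2 * s) ∧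
      L.weierstrassP (U - w) + L.weierstrassP (U + w)
        = 4 * z * ζ ^ 2 - 2 * v * ζ + 2 * x / 3 := by
  rcases h with ⟨rfl, hU⟩ | ⟨hζ, h⟩
  · refine ⟨fun hm ↦ d.notMem ?_, fun hm ↦ d.notMem ?_, ?_, ?_⟩
    · simpa using sub_mem hU hm
    · simpa using sub_mem hm hU
    · rw [L.zetaKernel_of_mem d.notMem hU]
      simp
    · rw [L.weierstrassP_add_add_of_mem hU, d.weierstrassP_eq]
      linear_combination -d.four_eq
  · refine ⟨L.sub_notMem_lattice (d.weierstrassP_ne hζ h),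
      L.add_notMem_lattice (d.weierstrassP_ne hζ h), ?_, d.weierstrassP_add_add hζ h⟩
    rw [d.zetaKernel_eq hζ h]
    have := d.s_ne
    field_simp
    ring

namespace IsContour

theorem continuousOn_γ (C : IsContour x ρ v z α β L a b γ y u) (d : PoleData x ρ v z α β s L w) :
    ContinuousOn γ (Set.Icc a b) := by
  have h : ContinuousOn (fun t ↦ β - L.zetaKernel w (u t) / (2 * s)) (Set.Icc a b) := by
    refine continuousOn_const.sub (ContinuousOn.div_const ?_ _)
    intro t ht
    obtain ⟨h1, h2, -⟩ := d.lift_spec (C.lift t ht)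
    exact (L.hasDerivAt_zetaKernel h1 h2).continuousAt.comp_continuousWithinAt
      (C.continuousOn t ht)
  exact h.congr fun t ht ↦ (d.lift_spec (C.lift t ht)).2.2.1

/-- The relation `dζ = 2η du` can be divided by `2η` except at branch points and over `ζ = β`; the
path crosses these with nonzero speed only countably often. -/
theorem exists_countable_integrand_eq (C : IsContour x ρ v z α β L a b γ y u)
    (d : PoleData x ρ v z α β s L w) :
    ∃ S : Set ℝ, S.Countable ∧ ∀ t ∈ Set.Ioo a b \ S, DifferentiableAt ℝ u t ∧
      ∀ m, integrand m γ y t = γ t ^ m * deriv u t := by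
  obtain ⟨S, hS, hd⟩ := C.differentiable
  refine ⟨S ∪ {t | u t ∈ {v | v ∈ L.lattice ∨ L.derivWeierstrassP v = 0} ∧ deriv u t ≠ 0},
    hS.union (countable_setOf_mem_of_isolated
      (L.eventually_notMem_and_derivWeierstrassP_ne_zero d.notMem d.derivWeierstrassP_ne)), ?_⟩
  rintro t ⟨ht, htS⟩
  rw [Set.mem_union, not_or] at htS
  have hdt := hd t ⟨ht, htS.1⟩
  refine ⟨hdt, fun m ↦ ?_⟩
  have htI := Set.Ioo_subset_Icc_self ht
  obtain ⟨h1, h2, -⟩ := d.lift_spec (C.lift t htI)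
  have hγ : HasDerivAt γ (-((L.weierstrassP (u t + w) - L.weierstrassP (u t - w)) * deriv u t
      / (2 * s))) t := by
    have h3 := (((L.hasDerivAt_zetaKernel h1 h2).comp t hdt.hasDerivAt).div_const
      (2 * s)).const_sub β
    refine h3.congr_of_eventuallyEq ?_
    filter_upwards [Ioo_mem_nhds ht.1 ht.2] with r hr
    exact (d.lift_spec (C.lift r (Set.Ioo_subset_Icc_self hr))).2.2.1
  unfold integrand
  rw [hγ.deriv]
  -- Here `γ' = 0` as well, so both sides vanish whatever `y t` is, even zero.
  by_cases h0 : deriv u t = 0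
  · simp [h0]
  have hreg : ¬(u t ∈ L.lattice ∨ L.derivWeierstrassP (u t) = 0) := fun h ↦ htS.2 ⟨h, h0⟩
  rw [not_or] at hreg
  obtain ⟨hζ, h⟩ := (C.lift t htI).resolve_left fun h ↦ hreg.1 h.2
  have hy : y t ≠ 0 := by
    intro hy
    apply hreg.2
    rw [h.2.2, YMap, hy]
    simp
  have hs := d.s_ne
  rw [d.weierstrassP_add_sub hζ h]
  field_simp
  ring

theorem ae_integrand_eq (C : IsContour x ρ v z α β L a b γ y u)
    (d : PoleData x ρ v z α β s L w) (m : ℕ) :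
    ∀ᵐ t, t ∈ Set.uIoc a b → γ t ^ m * deriv u t = integrand m γ y t := by
  obtain ⟨S, hS, h⟩ := C.exists_countable_integrand_eq d
  -- `Set.uIoc a b` contains `b`, while the pointwise identity is known on the open interval only.
  have h0 : ∀ᵐ t, t ∉ S ∪ {b} :=
    MeasureTheory.measure_eq_zero_iff_ae_notMem.mp
      ((hS.union (Set.countable_singleton b)).measure_zero _)
  filter_upwards [h0] with t ht htI
  rw [Set.uIoc_of_le C.le] at htI
  rw [Set.mem_union, not_or] at ht
  exact ((h t ⟨⟨htI.1, lt_of_le_of_ne htI.2 ht.2⟩, ht.1⟩).2 m).symm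

theorem intervalIntegrable_integrand (C : IsContour x ρ v z α β L a b γ y u)
    (d : PoleData x ρ v z α β s L w) (m : ℕ) :
    IntervalIntegrable (integrand m γ y) MeasureTheory.volume a b := by
  refine (intervalIntegrable_comp_mul_deriv C.le C.integrable_deriv
    ((C.continuousOn_γ d).pow m)).congr_ae ?_
  rw [EventuallyEq, MeasureTheory.ae_restrict_iff' measurableSet_uIoc]
  exact C.ae_integrand_eq d m

theorem I_eq (C : IsContour x ρ v z α β L a b γ y u) (d : PoleData x ρ v z α β s L w) (m : ℕ) :
    I m γ y a b = ∫ t in a..b, γ t ^ m * deriv u t :=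
  (intervalIntegral.integral_congr_ae (C.ae_integrand_eq d m)).symm

theorem I_zero_eq (C : IsContour x ρ v z α β L a b γ y u) (d : PoleData x ρ v z α β s L w) :
    I 0 γ y a b = u b - u a := by
  obtain ⟨S, hS, h⟩ := C.differentiable
  rw [C.I_eq d]
  exact integral_comp_mul_deriv_off_countable C.le C.integrable_deriv hS C.continuousOn
    ((C.continuousOn_γ d).pow 0) fun t ht ↦ (h t ht).hasDerivAt.congr_deriv (by simp)

theorem exists_log (C : IsContour x ρ v z α β L a b γ y u) (d : PoleData x ρ v z α β s L w) :
    ∃ ℓ : ℝ → ℂ, ContinuousOn ℓ (Set.Icc a b) ∧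
      (∀ t ∈ Set.Icc a b, Complex.exp (ℓ t) =
        L.weierstrassSigma (u t - w) / L.weierstrassSigma (u t + w)) ∧
      I 1 γ y a b = -(1 / (2 * s)) * ((ℓ b - ℓ a)
        + (2 * L.weierstrassZeta w - 2 * s * β) * (u b - u a)) := by
  have hσ : ∀ t ∈ Set.Icc a b, L.weierstrassSigma (u t - w) ≠ 0 ∧
      L.weierstrassSigma (u t + w) ≠ 0 := fun t ht ↦
    ⟨L.weierstrassSigma_ne_zero (d.lift_spec (C.lift t ht)).1,
      L.weierstrassSigma_ne_zero (d.lift_spec (C.lift t ht)).2.1⟩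
  have hcont : ContinuousOn (fun t ↦ L.weierstrassSigma (u t - w) / L.weierstrassSigma (u t + w))
      (Set.Icc a b) := by
    intro t ht
    obtain ⟨h1, h2, -⟩ := d.lift_spec (C.lift t ht)
    have e1 := ((L.hasDerivAt_weierstrassSigma h1).comp_sub_const (u t) w).continuousAt
    have e2 := ((L.hasDerivAt_weierstrassSigma h2).comp_add_const (u t) w).continuousAt
    exact (e1.div e2 (hσ t ht).2).comp_continuousWithinAt (C.continuousOn t ht)
  obtain ⟨ℓ, hℓ, he⟩ := exists_continuousOn_exp_eq C.le hcont
    fun t ht ↦ div_ne_zero (hσ t ht).1 (hσ t ht).2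
  refine ⟨ℓ, hℓ, he, ?_⟩
  obtain ⟨S, hS, hd⟩ := C.differentiable
  have hs := d.s_ne
  have key := integral_comp_mul_deriv_off_countable (f := fun t ↦ γ t ^ 1)
    (F := fun t ↦ -(1 / (2 * s)) * (ℓ t + (2 * L.weierstrassZeta w - 2 * s * β) * u t))
    C.le C.integrable_deriv hS
    (continuousOn_const.mul (hℓ.add (continuousOn_const.mul C.continuousOn)))
    ((C.continuousOn_γ d).pow 1) (by
      intro t ht
      have htI := Set.Ioo_subset_Icc_self ht.1
      have hdt := (hd t ht).hasDerivAt
      obtain ⟨h1, h2, h3, -⟩ := d.lift_spec (C.lift t htI)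
      have e1 := ((L.hasDerivAt_weierstrassSigma h1).comp_sub_const (u t) w)
      have e2 := ((L.hasDerivAt_weierstrassSigma h2).comp_add_const (u t) w)
      have hσ1 := (hσ t htI).1
      have hσ2 := (hσ t htI).2
      have e3 := (e1.fun_div e2 hσ2).comp t hdt
      have hℓt : HasDerivAt ℓ ((L.weierstrassZeta (u t - w) - L.weierstrassZeta (u t + w))
          * deriv u t) t := by
        refine hasDerivAt_of_exp_eventuallyEq (g := fun t ↦
          L.weierstrassSigma (u t - w) / L.weierstrassSigma (u t + w))
          (hℓ.continuousAt (Icc_mem_nhds ht.1.1 ht.1.2)) ?_ (e3.congr_deriv ?_)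
        · filter_upwards [Icc_mem_nhds ht.1.1 ht.1.2] with r hr using he r hr
        · field_simp
      refine ((hℓt.fun_add (hdt.const_mul _)).const_mul _).congr_deriv ?_
      rw [h3, PeriodPair.zetaKernel]
      field_simp
      ring)
  rw [C.I_eq d, key]
  ring

/-- By the formula for `℘(u - w) + ℘(u + w)`, the function `ζ² - v/(2z) ζ` has a primitive in `u`
without logarithms. -/
theorem I_two_eq (C : IsContour x ρ v z α β L a b γ y u) (d : PoleData x ρ v z α β s L w) :
    I 2 γ y a b = -(1 / (4 * z)) *
      ((L.weierstrassZeta (u b - w) - L.weierstrassZeta (u a - w))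
        + (L.weierstrassZeta (u b + w) - L.weierstrassZeta (u a + w))
        + 2 * x / 3 * (u b - u a)) + v / (2 * z) * I 1 γ y a b := by
  obtain ⟨S, hS, hd⟩ := C.differentiable
  have hz := d.z_ne
  have hcont : ContinuousOn (fun t ↦ L.weierstrassZeta (u t - w) + L.weierstrassZeta (u t + w))
      (Set.Icc a b) := by
    intro t ht
    obtain ⟨h1, h2, -⟩ := d.lift_spec (C.lift t ht)
    have e1 := ((L.hasDerivAt_weierstrassZeta h1).comp_sub_const (u t) w).continuousAt
    have e2 := ((L.hasDerivAt_weierstrassZeta h2).comp_add_const (u t) w).continuousAt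
    exact (e1.add e2).comp_continuousWithinAt (C.continuousOn t ht)
  have hγ := C.continuousOn_γ d
  have key := integral_comp_mul_deriv_off_countable
    (f := fun t ↦ γ t ^ 2 - v / (2 * z) * γ t ^ 1)
    (F := fun t ↦ -(1 / (4 * z)) * (L.weierstrassZeta (u t - w) + L.weierstrassZeta (u t + w)
      + 2 * x / 3 * u t)) C.le C.integrable_deriv hS
    (continuousOn_const.mul (hcont.add (continuousOn_const.mul C.continuousOn)))
    ((hγ.pow 2).sub (continuousOn_const.mul (hγ.pow 1))) (by
      intro t ht
      have htI := Set.Ioo_subset_Icc_self ht.1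
      have hdt := (hd t ht).hasDerivAt
      obtain ⟨h1, h2, -, h4⟩ := d.lift_spec (C.lift t htI)
      have e1 := (L.hasDerivAt_weierstrassZeta h1).comp_sub_const (u t) w
      have e2 := (L.hasDerivAt_weierstrassZeta h2).comp_add_const (u t) w
      refine ((((e1.fun_add e2).comp t hdt).fun_add (hdt.const_mul (2 * x / 3 : ℂ))).const_mul
        (-(1 / (4 * z)))).congr_deriv ?_
      rw [← neg_add, h4]
      field_simp
      ring)
  have hint : ∀ m, IntervalIntegrable (fun t ↦ γ t ^ m * deriv u t) MeasureTheory.volume a b :=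
    fun m ↦ intervalIntegrable_comp_mul_deriv C.le C.integrable_deriv (hγ.pow m)
  simp only [sub_mul, mul_assoc (v / (2 * z))] at key
  rw [intervalIntegral.integral_sub (hint 2) ((hint 1).const_mul _),
    intervalIntegral.integral_const_mul, ← C.I_eq d, ← C.I_eq d, sub_eq_iff_eq_add] at key
  rw [key]
  ring

theorem I_two_eq_complete2 (C : IsContour x ρ v z α β L a b γ y u)
    (d : PoleData x ρ v z α β s L w) {i : Fin 3} (hu : u b - u a = 2 * L.halfPeriod i) {up um e : ℂ}
    (h : I 1 γ y a b = complete1 L i s up um + e) :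
    I 2 γ y a b = complete2 L i x v z s up um + v / (2 * z) * e := by
  have hz := d.z_ne
  have hs := d.s_ne
  obtain ⟨h1, h2, -⟩ := d.lift_spec (C.lift a ⟨le_rfl, C.le⟩)
  have hω := L.halfPeriod_notMem_lattice i
  have hω2 := L.two_mul_halfPeriod_mem_lattice i
  rw [C.I_two_eq d, h, hu, show u b - w = u a - w + 2 * L.halfPeriod i by linear_combination hu,
    show u b + w = u a + w + 2 * L.halfPeriod i by linear_combination hu,
    L.weierstrassZeta_add_two_mul hω hω2 h1, L.weierstrassZeta_add_two_mul hω hω2 h2]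
  unfold complete1 complete2 PeriodPair.quasiHalfPeriod xPlus xMinus
  field_simp
  ring

theorem exists_I_one_eq_complete1 (C : IsContour x ρ v z α β L a b γ y u)
    (d : PoleData x ρ v z α β s L w) {i : Fin 3} (hu : u b - u a = 2 * L.halfPeriod i) {u₀ : ℂ}
    (h₀ : L.weierstrassZeta (w + u₀) + L.weierstrassZeta (w - u₀)
      = 2 * L.weierstrassZeta w - 2 * s * β) :
    ∃ n : ℤ, I 1 γ y a b = complete1 L i s (w + u₀) (w - u₀) + n * (Real.pi * Complex.I / s) := by
  obtain ⟨ℓ, -, he, hI⟩ := C.exists_log d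
  have hs := d.s_ne
  obtain ⟨h1, h2, -⟩ := d.lift_spec (C.lift a ⟨le_rfl, C.le⟩)
  have hω := L.halfPeriod_notMem_lattice i
  have hω2 := L.two_mul_halfPeriod_mem_lattice i
  have hσ1 := L.weierstrassSigma_ne_zero h1
  have hσ2 := L.weierstrassSigma_ne_zero h2
  have hexp : Complex.exp (ℓ b) = Complex.exp (ℓ a - 4 * L.weierstrassZeta (L.halfPeriod i) * w) := by
    rw [Complex.exp_sub, he b ⟨C.le, le_rfl⟩, he a ⟨le_rfl, C.le⟩,
      show u b - w = u a - w + 2 * L.halfPeriod i by linear_combination hu,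
      show u b + w = u a + w + 2 * L.halfPeriod i by linear_combination hu,
      L.weierstrassSigma_add_two_mul hω hω2 h1, L.weierstrassSigma_add_two_mul hω hω2 h2,
      show 2 * L.weierstrassZeta (L.halfPeriod i) * (u a + w + L.halfPeriod i)
        = 2 * L.weierstrassZeta (L.halfPeriod i) * (u a - w + L.halfPeriod i)
          + 4 * L.weierstrassZeta (L.halfPeriod i) * w by ring, Complex.exp_add]
    have := Complex.exp_ne_zero (2 * L.weierstrassZeta (L.halfPeriod i) * (u a - w + L.halfPeriod i))
    have := Complex.exp_ne_zero (4 * L.weierstrassZeta (L.halfPeriod i) * w)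
    field_simp
  obtain ⟨n, hn⟩ := Complex.exp_eq_exp_iff_exists_int.mp hexp
  -- The prefactor `-1/(2s)` turns `2πi n` into `-n πi/s`.
  refine ⟨-n, ?_⟩
  rw [hI, hn, hu, ← h₀]
  unfold complete1 PeriodPair.thirdKind
  push_cast
  field_simp
  ring

theorem I_one_eq_complete1 {i : Fin 3}
    (C : IsContour x ρ v z α β L 0 1 γ y (L.closedContour i))
    (d : PoleData x ρ v z α β s L w) {p q : ℝ}
    (hw : w = p * L.halfPeriod i + q * L.contourBase i) (hq : |q| < 1) {u₀ : ℂ}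
    (h₀ : L.weierstrassZeta (w + u₀) + L.weierstrassZeta (w - u₀)
      = 2 * L.weierstrassZeta w - 2 * s * β) :
    I 1 γ y 0 1 = complete1 L i s (w + u₀) (w - u₀) := by
  have hs := d.s_ne
  have hd : ∀ t : ℝ, HasDerivAt (L.closedContour i) (2 * L.halfPeriod i) t := by
    intro t
    have h : HasDerivAt (fun t : ℝ ↦ L.contourBase i + 2 * t * L.halfPeriod i)
        (2 * L.halfPeriod i) t :=
      ((((Complex.ofRealCLM.hasDerivAt (x := t)).const_mul 2).mul_const
        (L.halfPeriod i)).const_add (L.contourBase i)).congr_deriv (by simp)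
    exact h
  have key := L.integral_weierstrassZeta_sub (c := L.contourBase i) (w := w)
    (L.halfPeriod_notMem_lattice i) (L.two_mul_halfPeriod_mem_lattice i) (by
      intro t _ τ hτ
      obtain ⟨hq1, hq2⟩ := abs_lt.mp hq
      obtain ⟨hτ1, hτ2⟩ := hτ
      have e : L.contourBase i + 2 * t * L.halfPeriod i + τ * w
          = ((1 + τ * q : ℝ) : ℂ) * L.contourBase i + ((2 * t + τ * p : ℝ) : ℂ) * L.halfPeriod i := by
        rw [hw]
        push_cast
        ring
      rw [e]
      -- The coefficient `1 + τq` of the contour base stays strictly between `0` and `2`, so the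
      -- parallelogram misses the lattice.
      have hb : |τ * q| < 1 := by
        rw [abs_mul]
        exact lt_of_le_of_lt (mul_le_of_le_one_left (abs_nonneg q) (abs_le.mpr ⟨hτ1, hτ2⟩)) hq
      obtain ⟨hb1, hb2⟩ := abs_lt.mp hb
      exact L.contourBase_strip_notMem_lattice (by linarith) (by linarith))
  have hcont : ContinuousOn (fun t : ℝ ↦
      (L.weierstrassZeta (L.contourBase i + 2 * t * L.halfPeriod i - w)
      - L.weierstrassZeta (L.contourBase i + 2 * t * L.halfPeriod i + w)) * (2 * L.halfPeriod i))
      (Set.uIcc 0 1) := by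
    intro t ht
    rw [Set.uIcc_of_le zero_le_one] at ht
    obtain ⟨h1, h2, -⟩ := d.lift_spec (C.lift t ht)
    have e1 := ((L.hasDerivAt_weierstrassZeta h1).comp_sub_const _ w).continuousAt
    have e2 := ((L.hasDerivAt_weierstrassZeta h2).comp_add_const _ w).continuousAt
    exact (((e1.sub e2).comp (hd t).continuousAt).mul continuousAt_const).continuousWithinAt
  rw [C.I_eq d, intervalIntegral.integral_congr (g := fun t : ℝ ↦ -(1 / (2 * s)) *
      ((L.weierstrassZeta (L.contourBase i + 2 * t * L.halfPeriod i - w)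
      - L.weierstrassZeta (L.contourBase i + 2 * t * L.halfPeriod i + w)) * (2 * L.halfPeriod i)
      + (2 * L.weierstrassZeta w - 2 * s * β) * (2 * L.halfPeriod i))) (fun t ht ↦ by
    rw [Set.uIcc_of_le zero_le_one] at ht
    simp only
    rw [(hd t).deriv, (d.lift_spec (C.lift t ht)).2.2.1]
    unfold PeriodPair.zetaKernel PeriodPair.closedContour
    field_simp
    ring), intervalIntegral.integral_const_mul, intervalIntegral.integral_add
      hcont.intervalIntegrable intervalIntegrable_const, key, intervalIntegral.integral_const, ← h₀]
  unfold complete1 PeriodPair.thirdKind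
  simp only [sub_zero, one_smul]
  field_simp
  ring

end IsContour

end Contour

end O4

theorem mainTheorem5 (x ρ : ℝ) (v z α β s : ℂ)
    (hρ : 0 < ρ) (hz : z ≠ 0) (hαβ : α ≠ β) (hαβ' : 1 + starRingEnd ℂ α * β ≠ 0)
    (hη : ∀ ζ : ℂ, ζ ≠ 0 → O4.eta4 x v z ζ =
      ρ / ζ ^ 2 * ((ζ - α) * (starRingEnd ℂ α * ζ + 1) / (1 + (‖α‖ : ℂ) ^ 2))
        * ((ζ - β) * (starRingEnd ℂ β * ζ + 1) / (1 + (‖β‖ : ℂ) ^ 2)))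
    (hs : s ^ 2 = z)
    (L : PeriodPair) (hg2 : L.g₂ = 4 * O4.g2 x v z) (hg3 : L.g₃ = 4 * O4.g3 x v z)
    (uInf u0 : ℂ)
    (huInf : L.HasCoord (O4.XInf ρ α β) (O4.YInf ρ α β s) uInf)
    (hu0 : L.HasCoord (O4.XMap ρ α β 0) (O4.YMap ρ α β 0 (-starRingEnd ℂ s)) u0) :
    -- the points `u_∞^± = u_∞ ± u₀` lie over `x₊`, `x₋`
    (uInf + u0 ∉ L.lattice ∧ L.weierstrassP (uInf + u0) = O4.xPlus x z) ∧
    (uInf - u0 ∉ L.lattice ∧ L.weierstrassP (uInf - u0) = O4.xMinus x z) ∧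
    -- the incomplete integrals, over an arbitrary contour
    (∀ (a b : ℝ) (γ y u : ℝ → ℂ), O4.IsContour x ρ v z α β L a b γ y u →
      (∀ m : ℕ, m ≤ 2 →
        IntervalIntegrable (O4.integrand m γ y) MeasureTheory.volume a b) ∧
      O4.I 0 γ y a b = u b - u a ∧
      ∃ ℓ : ℝ → ℂ, ContinuousOn ℓ (Set.Icc a b) ∧
        (∀ t ∈ Set.Icc a b, L.weierstrassSigma (u t + uInf) ≠ 0 ∧
          Complex.exp (ℓ t) =
            L.weierstrassSigma (u t - uInf) / L.weierstrassSigma (u t + uInf)) ∧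
        O4.I 1 γ y a b = -(1 / (2 * s)) * ((ℓ b - ℓ a)
          + (L.weierstrassZeta (uInf + u0) + L.weierstrassZeta (uInf - u0)) * (u b - u a)) ∧
        O4.I 2 γ y a b = -(1 / (4 * z)) *
          ((L.weierstrassZeta (u b - uInf) - L.weierstrassZeta (u a - uInf))
            + (L.weierstrassZeta (u b + uInf) - L.weierstrassZeta (u a + uInf))
            + (O4.xPlus x z + O4.xMinus x z) * (u b - u a)
            + v / s * ((ℓ b - ℓ a)
              + (L.weierstrassZeta (uInf + u0) + L.weierstrassZeta (uInf - u0))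
                * (u b - u a)))) ∧
    -- the complete integrals, over an arbitrary contour with period `2ωᵢ`,
    -- modulo the residues at the two points over `ζ = ∞`
    (∀ (i : Fin 3) (a b : ℝ) (γ y u : ℝ → ℂ), O4.IsContour x ρ v z α β L a b γ y u →
      u b - u a = 2 * L.halfPeriod i →
      O4.I 0 γ y a b = 2 * L.halfPeriod i ∧
      ∃ n : ℤ,
        O4.I 1 γ y a b = O4.complete1 L i s (uInf + u0) (uInf - u0)
          + n * (Real.pi * Complex.I / s) ∧
        O4.I 2 γ y a b = O4.complete2 L i x v z s (uInf + u0) (uInf - u0)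
          + v / (2 * z) * (n * (Real.pi * Complex.I / s))) ∧
    -- the complete integrals over `Γᵢ`, exactly, when `u_∞` is represented in the open strip
    -- around the line `ℝ ωᵢ` that is bounded by the lines through `± Γᵢ`
    (∀ (i : Fin 3) (p q : ℝ), uInf = p * L.halfPeriod i + q * L.contourBase i → |q| < 1 →
      ∀ γ y : ℝ → ℂ, O4.IsContour x ρ v z α β L 0 1 γ y (L.closedContour i) →
        O4.I 0 γ y 0 1 = 2 * L.halfPeriod i ∧
        O4.I 1 γ y 0 1 = O4.complete1 L i s (uInf + u0) (uInf - u0) ∧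
        O4.I 2 γ y 0 1 = O4.complete2 L i x v z s (uInf + u0) (uInf - u0)) := by

  have d := O4.poleData hρ hz hαβ hαβ' hη hs hg2 huInf
  have h₀ := d.weierstrassZeta_add_zero hu0
  have hP := d.weierstrassP_add_zero hu0
  have hne := d.weierstrassP_ne d.β_ne.symm hu0
  have hx : O4.xPlus x z + O4.xMinus x z = 2 * x / 3 := by
    unfold O4.xPlus O4.xMinus
    ring
  have hsne := d.s_ne
  refine ⟨⟨L.add_notMem_lattice hne.symm, hP.1⟩, ⟨L.sub_notMem_lattice hne.symm, hP.2⟩, ?_, ?_, ?_⟩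
  · intro a b γ y u C
    obtain ⟨ℓ, hc, he, hI⟩ := C.exists_log d
    refine ⟨fun m _ ↦ C.intervalIntegrable_integrand d m, C.I_zero_eq d, ℓ, hc,
      fun t ht ↦ ⟨L.weierstrassSigma_ne_zero (d.lift_spec (C.lift t ht)).2.1, he t ht⟩, ?_, ?_⟩
    · rw [hI, h₀]
    · rw [C.I_two_eq d, hI, h₀, hx]
      field_simp
      ring
  · intro i a b γ y u C hu
    obtain ⟨n, hn⟩ := C.exists_I_one_eq_complete1 d hu h₀
    exact ⟨(C.I_zero_eq d).trans hu, n, hn, C.I_two_eq_complete2 d hu hn⟩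
  · intro i p q hw hq γ y C
    have hu : L.closedContour i 1 - L.closedContour i 0 = 2 * L.halfPeriod i := by
      simp [PeriodPair.closedContour]
    have h1 := C.I_one_eq_complete1 d hw hq h₀
    refine ⟨(C.I_zero_eq d).trans hu, h1, ?_⟩
    simpa using C.I_two_eq_complete2 d hu (e := 0) (by rw [h1, add_zero])
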